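/- For $w\in C([0,T];\mathbb R)$ and $\rho,\gamma>0$ put $\Phi^w_{s,t}(a)=\int_s^t e^{iaw_r}\,dr$, and say that $w$ is $(\rho,\gamma)$-irregular on $[0,T]$ if $$\sup_{a\in\mathbb R}\ \sup_{0\le s<t\le T}(1+|a|)^{\rho}\,\frac{|\Phi^w_{s,t}(a)|}{|s-t|^{\gamma}}<+\infty .$$ Let $A=i\partial_x^2$, let $(e^{tA})_{t\in\mathbb R}$ be the unitary group on $L^2(\mathbb R)=L^2(\mathbb R;\mathbb C)$ generated by $A$, and let $U^w_t=e^{w_tA}$. **Theorem (Strichartz estimate for the modulated Schrödinger group).** Let $p\in(2,5]$. There is $\gamma^\star(p)>0$, depending only on $p$, such that the following holds. Let $T>0$, $\rho>\min\left(\frac32-\frac2p,\,1\right)$, $\gamma>\frac12$, and let $w$ be $(\rho,\gamma)$-irregular on $[0,T]$. Then there is a finite constant $C_{w,T}>0$ (which may also depend on $p,\rho,\gamma$) such that for every $T'\in(0,T]$ and every $\psi\in L^1([0,T'],L^2(\mathbb R))$ the Bochner integrals $\int_0^tU^w_t(U^w_s)^{-1}\psi_s\,ds$, $t\in[0,T']$,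 are well defined in $L^2(\mathbb R)$, the function $t\mapsto\int_0^tU^w_t(U^w_s)^{-1}\psi_s\,ds$ belongs to $L^p([0,T'],L^{2p}(\mathbb R))$, and $$\left\|\int_0^{\cdot}U^w_{\cdot}(U^w_s)^{-1}\psi_s\,ds\right\|_{L^p([0,T'],L^{2p}(\mathbb R))}\le C_{w,T}\,(T')^{\gamma^\star(p)}\,\|\psi\|_{L^1([0,T'],L^2(\mathbb R))}.$$ -/

import Mathlib

open MeasureTheory Set
open scoped ENNReal

noncomputable section

namespace ModulatedSchrodinger

/-- The complex Hilbert space `L²(ℝ)`. -/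
abbrev L2 : Type := Lp ℂ 2 (volume : Measure ℝ)

/-! ### Irregular paths -/

/-- The Fourier transform `Φ^w_{s,t}(a) = ∫_s^t e^{i a w_r} dr` of the occupation measure. -/
def occupationFourier (w : ℝ → ℝ) (s t a : ℝ) : ℂ :=
  ∫ r in s..t, Complex.exp (Complex.I * ((a * w r : ℝ) : ℂ))

/-- The quantity
`sup_{a ∈ ℝ} sup_{0 ≤ s < t ≤ T} (1 + |a|)^ρ |Φ^w_{s,t}(a)| / |s - t|^γ`, in `[0, ∞]`. -/
def irregularityNorm (ρ γ T : ℝ) (w : ℝ → ℝ) : ℝ≥0∞ :=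
  ⨆ (a : ℝ) (s : ℝ) (t : ℝ) (_ : 0 ≤ s ∧ s < t ∧ t ≤ T),
    ENNReal.ofReal ((1 + |a|) ^ ρ * (‖occupationFourier w s t a‖ / |s - t| ^ γ))

/-- `w ∈ C([0,T]; ℝ)` is `(ρ, γ)`-irregular on `[0, T]`. -/
structure IsIrregularOn (ρ γ T : ℝ) (w : ℝ → ℝ) : Prop where
  rho_pos : 0 < ρ
  gamma_pos : 0 < γ
  continuousOn : ContinuousOn w (Icc 0 T)
  norm_lt_top : irregularityNorm ρ γ T w < ∞

/-! ### The Schrödinger group -/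

theorem norm_exp_phase (x : ℝ) : ‖Complex.exp (Complex.I * (x : ℂ))‖ = 1 := by
  rw [mul_comm, Complex.norm_exp_ofReal_mul_I]

theorem memLp_phase_mul {θ : ℝ → ℝ} (hθ : Continuous θ) (f : L2) :
    MemLp (fun ξ : ℝ => Complex.exp (Complex.I * (θ ξ : ℂ)) * f ξ) 2 volume := by
  have hm : AEStronglyMeasurable
      (fun ξ : ℝ => Complex.exp (Complex.I * (θ ξ : ℂ)) * f ξ) volume :=
    (Continuous.aestronglyMeasurable (by fun_prop)).mul (Lp.aestronglyMeasurable f)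
  refine (memLp_congr_norm hm (Lp.aestronglyMeasurable f) ?_).2 (Lp.memLp f)
  filter_upwards with ξ
  rw [norm_mul, norm_exp_phase, one_mul]

/-- The multiplication operator `f ↦ e^{iθ} f` on `L²(ℝ)`, for a continuous real phase `θ`. -/
def phaseMul (θ : ℝ → ℝ) (hθ : Continuous θ) (f : L2) : L2 :=
  (memLp_phase_mul hθ f).toLp _

theorem coeFn_phaseMul {θ : ℝ → ℝ} (hθ : Continuous θ) (f : L2) :
    phaseMul θ hθ f =ᵐ[volume] fun ξ : ℝ => Complex.exp (Complex.I * (θ ξ : ℂ)) * f ξ :=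
  MemLp.coeFn_toLp _

theorem phaseMul_neg_phaseMul {θ η : ℝ → ℝ} (hθ : Continuous θ) (hη : Continuous η)
    (h : ∀ ξ, θ ξ + η ξ = 0) (f : L2) : phaseMul θ hθ (phaseMul η hη f) = f := by
  apply Lp.ext
  filter_upwards [coeFn_phaseMul hθ (phaseMul η hη f), coeFn_phaseMul hη f] with ξ h1 h2
  rw [h1, h2, ← mul_assoc, ← Complex.exp_add, ← mul_add, ← Complex.ofReal_add, h ξ]
  simp

/-- The Fourier side of `e^{t i ∂²}`: multiplication by the symbol `e^{-i t (2πξ)²}`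
(Mathlib's Fourier transform is `f̂(ξ) = ∫ e^{-2πi x ξ} f(x) dx`, so that `∂²` has the symbol
`-(2πξ)²`), as a unitary operator of `L²(ℝ)`. -/
def schrodingerSymbol (t : ℝ) : L2 ≃ₗᵢ[ℂ] L2 where
  toFun := phaseMul (fun ξ => -t * (2 * Real.pi * ξ) ^ 2) (by fun_prop)
  invFun := phaseMul (fun ξ => t * (2 * Real.pi * ξ) ^ 2) (by fun_prop)
  map_add' f g := by
    apply Lp.ext
    filter_upwards [coeFn_phaseMul (θ := fun ξ => -t * (2 * Real.pi * ξ) ^ 2) (by fun_prop) (f + g),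
      coeFn_phaseMul (θ := fun ξ => -t * (2 * Real.pi * ξ) ^ 2) (by fun_prop) f,
      coeFn_phaseMul (θ := fun ξ => -t * (2 * Real.pi * ξ) ^ 2) (by fun_prop) g,
      Lp.coeFn_add f g,
      Lp.coeFn_add (phaseMul (fun ξ => -t * (2 * Real.pi * ξ) ^ 2) (by fun_prop) f)
        (phaseMul (fun ξ => -t * (2 * Real.pi * ξ) ^ 2) (by fun_prop) g)] with ξ h1 h2 h3 h4 h5
    rw [h5, h1, Pi.add_apply, h2, h3, h4, Pi.add_apply, mul_add]
  map_smul' c f := by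
    apply Lp.ext
    filter_upwards [coeFn_phaseMul (θ := fun ξ => -t * (2 * Real.pi * ξ) ^ 2) (by fun_prop) (c • f),
      coeFn_phaseMul (θ := fun ξ => -t * (2 * Real.pi * ξ) ^ 2) (by fun_prop) f,
      Lp.coeFn_smul c f,
      Lp.coeFn_smul c (phaseMul (fun ξ => -t * (2 * Real.pi * ξ) ^ 2) (by fun_prop) f)]
      with ξ h1 h2 h3 h4
    simp only [RingHom.id_apply]
    rw [h4, h1, Pi.smul_apply, h2, h3, Pi.smul_apply, smul_eq_mul, smul_eq_mul]
    ring
  left_inv f := phaseMul_neg_phaseMul _ _ (fun ξ => by ring) f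
  right_inv f := phaseMul_neg_phaseMul _ _ (fun ξ => by ring) f
  norm_map' f := by
    change ‖phaseMul (fun ξ => -t * (2 * Real.pi * ξ) ^ 2) (by fun_prop) f‖ = ‖f‖
    rw [Lp.norm_def, Lp.norm_def]
    congr 1
    apply eLpNorm_congr_norm_ae
    filter_upwards [coeFn_phaseMul (θ := fun ξ => -t * (2 * Real.pi * ξ) ^ 2) (by fun_prop) f]
      with ξ h1
    rw [h1, norm_mul, norm_exp_phase, one_mul]

/-- The unitary group `e^{tA}` of `L²(ℝ)` generated by `A = i ∂²`. -/
def schrodingerGroup (t : ℝ) : L2 ≃ₗᵢ[ℂ] L2 :=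
  ((Lp.fourierTransformₗᵢ ℝ ℂ).trans (schrodingerSymbol t)).trans (Lp.fourierTransformₗᵢ ℝ ℂ).symm

/-- The modulated group `U^w_t = e^{A w_t}`. -/
def modulatedGroup (w : ℝ → ℝ) (t : ℝ) : L2 ≃ₗᵢ[ℂ] L2 :=
  schrodingerGroup (w t)

/-- The integrand `U^w_t (U^w_s)⁻¹ ψ_s`. -/
def duhamelIntegrand (w : ℝ → ℝ) (ψ : ℝ → L2) (t s : ℝ) : L2 :=
  modulatedGroup w t ((modulatedGroup w s).symm (ψ s))

/-- The Bochner integral `∫_0^t U^w_t (U^w_s)⁻¹ ψ_s ds` in `L²(ℝ)`. -/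
def duhamel (w : ℝ → ℝ) (ψ : ℝ → L2) (t : ℝ) : L2 :=
  ∫ s in (0 : ℝ)..t, duhamelIntegrand w ψ t s

/-! ### The mixed space `L^p([0,T], L^q(ℝ))` -/

/-- The family `u_t ∈ L²(ℝ)`, `t ∈ [0, T]`, lies in the Bochner space `L^p([0,T], L^q(ℝ))` and its
norm there is at most `M`: for almost every `t` the function `u_t` agrees almost everywhere on `ℝ`
with an element `v_t` of `L^q(ℝ)`, where `v` is strongly measurable and `p`-integrable. -/
def MixedNormLE (p q : ℝ≥0∞) (hq : 1 ≤ q) (T : ℝ) (u : ℝ → L2) (M : ℝ≥0∞) : Prop :=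
  haveI : Fact (1 ≤ q) := ⟨hq⟩
  ∃ v : ℝ → Lp ℂ q (volume : Measure ℝ),
    (∀ᵐ t ∂(volume.restrict (Icc 0 T)), (v t : ℝ → ℂ) =ᵐ[volume] (u t : ℝ → ℂ)) ∧
    MemLp v p (volume.restrict (Icc 0 T)) ∧
    eLpNorm v p (volume.restrict (Icc 0 T)) ≤ M

theorem one_le_ofReal_two_mul {p : ℝ} (hp : p ∈ Ioc (2 : ℝ) 5) :
    1 ≤ ENNReal.ofReal (2 * p) := by
  rw [ENNReal.one_le_ofReal]
  linarith [hp.1]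

end ModulatedSchrodinger

end

/-!
The inhomogeneous estimate follows from the homogeneous one by Minkowski's inequality: with
`χ_s = (U^w_s)⁻¹ ψ_s` the Duhamel term is `U^w_t ∫_0^t χ_s ds` (`lintegral_primitiveFlow_le`).

For the homogeneous estimate let `‖φ‖ ≤ 1`, let `u_t = U^w_t φ`, and consider the density
`f_t = |u_t|²`. Its Fourier transform is the autocorrelation of the Fourier transform of `u_t`, in
which the quadratic phases `w_t (2πη)²` combine to a phase that is affine in `η` with slope
proportional to `w_t ξ`. Expanding the square and integrating over `t ∈ [0, τ]` therefore produces
the Fourier transform `Φ^w_{0,τ}` of the occupation measure at a multiple of `ξ (η - η')`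
(`setLIntegral_enorm_sq_oscillatory_le`), and irregularity bounds
`∫_0^τ ∫ |ξ|^β |𝓕 f_t(ξ)|² dξ dt` by `τ^γ` times the quadrilinear form with kernel
`|ξ|^β (1 + |ξ| |η - η'|)^{-ρ}`. A Schur test bounds that form
(`exists_schurForm_irregularKernel_le`) if either `ρ > 1` and `β = 1`, or `0 < β < min 1 (2ρ - 1)`.
So averaging in time along the path gains `β / 2` derivatives on the density.

The gain is converted into integrability by a Sobolev inequality with the Gagliardo seminorm,
`∫ |f|^{2 + qβ} ≤ C (∫ |f|^q)^β ∫ ∫ |f(x) - f(x + y)|² y^{-1-β} dy dx`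
(`lintegral_rpow_le_gagliardo`), which is an elementary consequence of Chebyshev's inequality. As
`f_t` is bounded in `L¹`, using it for `q = 1` and then for `q = 2 + β` controls every `L^p` norm of
`f_t` with `p ≤ 2 + (2 + β) β`. For `β = 1` the upper limit is `5`; for `ρ ≤ 1`, which forces
`p < 4`, the choice `β = 2 - 4 / p < 2ρ - 1` suffices (`exists_smoothing_exponent`). Moreover
`‖u_t‖_{L^{2p}}^p` is at most a constant times `1` plus the squared Gagliardo seminorm of `f_t`, so
that its integral over `[0, τ]` is `O(τ + τ^γ) = O(τ^{1/2})`, and `γ⋆ = 1 / (2p)`.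

All estimates are proved for data with Schwartz Fourier transform and pass to `L²` by Fatou's lemma:
the `L^q` norm is lower semicontinuous on `L²` (`lowerSemicontinuous_eLpNorm_sub`). The same fact
yields the strong measurability of the solution as an `L^q`-valued function.
-/

namespace ModulatedSchrodinger

/-! ### A real-variable Sobolev inequality -/

/-- The square of the one-sided Gagliardo seminorm of order `β / 2`:
`∫ ∫_{y > 0} ‖f x - f (x + y)‖² y^{-1-β} dy dx`. -/
noncomputable def gagliardo (β : ℝ) (f : ℝ → ℂ) : ℝ≥0∞ :=
  ∫⁻ x, ∫⁻ y in Ioi (0 : ℝ), ‖f x - f (x + y)‖ₑ ^ 2 * ENNReal.ofReal (y ^ (-1 - β))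

/-- Pointwise form of the Sobolev inequality. By Chebyshev, `‖f (x + y)‖ < ‖f x‖ / 2` for at least
half of the `y ∈ (0, r)` as soon as `r` is `2 (2 / ‖f x‖)^q B`, and on these `y` the increment
`f x - f (x + y)` is at least `‖f x‖ / 2`. -/
theorem enorm_rpow_le_lintegral_increment {f : ℝ → ℂ} (hf : Measurable f) {q β B : ℝ}
    (hq : 0 < q) (hβ : 0 < β) (hB : 0 < B)
    (hfB : ∫⁻ x, ‖f x‖ₑ ^ q ≤ ENNReal.ofReal B) (x : ℝ) :
    ‖f x‖ₑ ^ (2 + q * β) ≤ ENNReal.ofReal (8 * 2 ^ β * 2 ^ (q * β) * B ^ β) *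
      ∫⁻ y in Ioi (0 : ℝ), ‖f x - f (x + y)‖ₑ ^ 2 * ENNReal.ofReal (y ^ (-1 - β)) := by
  rcases eq_or_ne (f x) 0 with h0 | h0
  · have : 0 < 2 + q * β := by positivity
    simp [h0, ENNReal.zero_rpow_of_pos this]
  set F : ℝ := ‖f x‖ with hF
  have hFpos : 0 < F := norm_pos_iff.2 h0
  set m : ℝ := (2 / F) ^ q * B with hm
  have hmpos : 0 < m := by positivity
  have hFe : ‖f x‖ₑ = ENNReal.ofReal F := (ofReal_norm _).symm
  -- the set of `y` at which `f (x + y)` is large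
  set S : Set ℝ := {y | ENNReal.ofReal ((F / 2) ^ q) ≤ ‖f (x + y)‖ₑ ^ q} with hS
  have hmeas : Measurable fun y => ‖f (x + y)‖ₑ ^ q := by fun_prop
  have hSm : MeasurableSet S := measurableSet_le measurable_const hmeas
  have hSvol : volume S ≤ ENNReal.ofReal m := by
    have h1 := mul_meas_ge_le_lintegral₀ (μ := volume) hmeas.aemeasurable
      (ENNReal.ofReal ((F / 2) ^ q))
    have h2 : ∫⁻ y, ‖f (x + y)‖ₑ ^ q = ∫⁻ y, ‖f y‖ₑ ^ q :=
      lintegral_add_left_eq_self (fun y => ‖f y‖ₑ ^ q) x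
    have hpos : 0 < (F / 2) ^ q := by positivity
    rw [h2] at h1
    have h3 := h1.trans hfB
    have h4 : m = B / (F / 2) ^ q := by
      rw [hm, Real.div_rpow (by norm_num) hFpos.le, Real.div_rpow hFpos.le (by norm_num)]
      field_simp
    rw [h4, ENNReal.ofReal_div_of_pos hpos, ENNReal.le_div_iff_mul_le (by simp [hpos])
      (by simp), mul_comm]
    exact h3
  have hE : ENNReal.ofReal m ≤ volume (Ioo 0 (2 * m) \ S) := by
    have h1 : volume (Ioo 0 (2 * m)) - volume S ≤ volume (Ioo 0 (2 * m) \ S) := le_measure_sdiff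
    refine le_trans ?_ h1
    rw [Real.volume_Ioo, sub_zero, two_mul, ENNReal.ofReal_add hmpos.le hmpos.le]
    refine le_trans ?_ (tsub_le_tsub_left hSvol _)
    rw [ENNReal.add_sub_cancel_right (by simp)]
  have hlow : ENNReal.ofReal ((F / 2) ^ 2 * (2 * m) ^ (-1 - β)) * ENNReal.ofReal m ≤
      ∫⁻ y in Ioi (0 : ℝ), ‖f x - f (x + y)‖ₑ ^ 2 * ENNReal.ofReal (y ^ (-1 - β)) := by
    calc _ ≤ ENNReal.ofReal ((F / 2) ^ 2 * (2 * m) ^ (-1 - β)) *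
          volume (Ioo 0 (2 * m) \ S) := by gcongr
      _ = ∫⁻ y in Ioo 0 (2 * m) \ S, ENNReal.ofReal ((F / 2) ^ 2 * (2 * m) ^ (-1 - β)) := by
        rw [setLIntegral_const]
      _ ≤ ∫⁻ y in Ioo 0 (2 * m) \ S,
          ‖f x - f (x + y)‖ₑ ^ 2 * ENNReal.ofReal (y ^ (-1 - β)) := by
        apply setLIntegral_mono' (measurableSet_Ioo.diff hSm)
        rintro y ⟨⟨hy0, hy1⟩, hyS⟩
        have hlt : ‖f (x + y)‖ < F / 2 := by
          simp only [hS, mem_ofPred_eq, not_le] at hyS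
          rw [← ofReal_norm, ENNReal.ofReal_rpow_of_nonneg (norm_nonneg _) hq.le] at hyS
          have := (ENNReal.ofReal_lt_ofReal_iff (by positivity)).1 hyS
          exact lt_of_not_ge fun h => this.not_ge (Real.rpow_le_rpow (by positivity) h hq.le)
        have hinc : F / 2 ≤ ‖f x - f (x + y)‖ := by
          have := norm_sub_norm_le (f x) (f (x + y))
          linarith
        rw [← ofReal_norm, ← ENNReal.ofReal_pow (norm_nonneg _),
          ← ENNReal.ofReal_mul (by positivity)]
        apply ENNReal.ofReal_le_ofReal
        gcongr 1
        · gcongr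
        · exact Real.rpow_le_rpow_of_nonpos hy0 hy1.le (by linarith)
      _ ≤ _ := lintegral_mono_set fun y hy => hy.1.1
  refine le_trans (le_of_eq ?_) (mul_le_mul_right hlow _)
  rw [← ENNReal.ofReal_mul (by positivity), ← ENNReal.ofReal_mul (by positivity), hFe,
    ENNReal.ofReal_rpow_of_nonneg hFpos.le (by positivity)]
  congr 1
  have e1 : (2 * m) ^ (-1 - β) =
      (2 * m)⁻¹ * (2 ^ β * (2 ^ (q * β) * (F ^ (q * β))⁻¹ * B ^ β))⁻¹ := by
    rw [sub_eq_add_neg, Real.rpow_add (by positivity), Real.rpow_neg_one,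
      Real.rpow_neg (by positivity), Real.mul_rpow (by norm_num) hmpos.le, hm,
      Real.mul_rpow (by positivity) hB.le, ← Real.rpow_mul (by positivity),
      Real.div_rpow (z := q * β) (by norm_num) hFpos.le, div_eq_mul_inv (2 ^ (q * β))]
  rw [e1, Real.rpow_add hFpos, Real.rpow_two]
  have : (2:ℝ) ^ β ≠ 0 := by positivity
  have : (2:ℝ) ^ (q * β) ≠ 0 := by positivity
  have : F ^ (q * β) ≠ 0 := by positivity
  have : B ^ β ≠ 0 := by positivity
  field_simp
  norm_num

/-- An `L^q` bound and a finite Gagliardo seminorm of order `β / 2` give an `L^{2 + qβ}` bound. -/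
theorem lintegral_rpow_le_gagliardo {f : ℝ → ℂ} (hf : Measurable f) {q β B : ℝ}
    (hq : 0 < q) (hβ : 0 < β) (hB : 0 < B)
    (hfB : ∫⁻ x, ‖f x‖ₑ ^ q ≤ ENNReal.ofReal B) :
    ∫⁻ x, ‖f x‖ₑ ^ (2 + q * β) ≤
      ENNReal.ofReal (8 * 2 ^ β * 2 ^ (q * β) * B ^ β) * gagliardo β f := by
  rw [gagliardo, ← lintegral_const_mul' _ _ ENNReal.ofReal_ne_top]
  exact lintegral_mono fun x => enorm_rpow_le_lintegral_increment hf hq hβ hB hfB x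

/-- Two applications of the Sobolev inequality, starting from `L¹` and passing through `L^{2 + β}`,
bound the `L^p` norm for every `p` up to `2 + (2 + β) β`. -/
theorem exists_lintegral_rpow_rpow_half_le {p β : ℝ} (hp : 1 ≤ p) (hβ : 0 < β) (hβ1 : β ≤ 1)
    (hpβ : p ≤ 2 + (2 + β) * β) :
    ∃ C : ℝ, 0 < C ∧ ∀ f : ℝ → ℂ, Measurable f → ∫⁻ x, ‖f x‖ₑ ≤ 1 →
      (∫⁻ x, ‖f x‖ₑ ^ p) ^ (1 / 2 : ℝ) ≤ ENNReal.ofReal C * (1 + gagliardo β f) := by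
  set C₁ : ℝ := 8 * 2 ^ β * 2 ^ (1 * β) * 1 ^ β with hC₁
  set C₂ : ℝ := 8 * 2 ^ β * 2 ^ ((2 + β) * β) * C₁ ^ β with hC₂
  have hC₁p : 0 < C₁ := by positivity
  have hC₂p : 0 < C₂ := by positivity
  refine ⟨1 + C₂, by positivity, fun f hf hf1 => ?_⟩
  rcases eq_or_ne (gagliardo β f) ∞ with htop | htop
  · rw [htop, add_top, ENNReal.mul_top (by simp; positivity)]
    exact le_top
  set h : ℝ := (gagliardo β f).toReal with hh
  have hh0 : 0 ≤ h := ENNReal.toReal_nonneg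
  have hG : gagliardo β f = ENNReal.ofReal h := (ENNReal.ofReal_toReal htop).symm
  have s1 : ∫⁻ x, ‖f x‖ₑ ^ (2 + β) ≤ ENNReal.ofReal (C₁ * (1 + h)) := by
    have := lintegral_rpow_le_gagliardo hf (q := 1) (B := 1) one_pos hβ one_pos
      (by simpa using hf1)
    rw [← hC₁, one_mul, hG, ← ENNReal.ofReal_mul hC₁p.le] at this
    refine this.trans (ENNReal.ofReal_le_ofReal ?_)
    -- `1 + h` rather than `h`, so that the bound is positive when it is fed back below
    gcongr
    linarith
  have s2 : ∫⁻ x, ‖f x‖ₑ ^ (2 + (2 + β) * β) ≤ ENNReal.ofReal (C₂ * (1 + h) ^ (2 : ℕ)) := by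
    have := lintegral_rpow_le_gagliardo hf (q := 2 + β) (B := C₁ * (1 + h)) (by positivity) hβ
      (by positivity) s1
    rw [hG, ← ENNReal.ofReal_mul (by positivity)] at this
    refine this.trans (ENNReal.ofReal_le_ofReal ?_)
    have h1 : (1 + h) ^ β ≤ 1 + h := by
      simpa using Real.rpow_le_rpow_of_exponent_le (by linarith : 1 ≤ 1 + h) hβ1
    rw [Real.mul_rpow hC₁p.le (by positivity), ← mul_assoc, ← hC₂, mul_assoc, sq]
    gcongr
    linarith
  have s3 : ∫⁻ x, ‖f x‖ₑ ^ p ≤ ENNReal.ofReal (((1 + C₂) * (1 + h)) ^ (2 : ℕ)) := by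
    -- `|f|^p` is at most `|f|` where `|f| ≤ 1` and at most `|f|^{2 + (2 + β) β}` elsewhere
    calc ∫⁻ x, ‖f x‖ₑ ^ p ≤ ∫⁻ x, (‖f x‖ₑ + ‖f x‖ₑ ^ (2 + (2 + β) * β)) := by
          refine lintegral_mono fun x => ?_
          rcases le_total ‖f x‖ₑ 1 with h1 | h1
          · refine le_trans ?_ le_self_add
            simpa using ENNReal.rpow_le_rpow_of_exponent_ge h1 hp
          · exact le_trans (ENNReal.rpow_le_rpow_of_exponent_le h1 hpβ) le_add_self
      _ ≤ 1 + ENNReal.ofReal (C₂ * (1 + h) ^ (2 : ℕ)) := by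
          rw [lintegral_add_left (by fun_prop)]
          gcongr
      _ ≤ _ := by
          rw [← ENNReal.ofReal_one, ← ENNReal.ofReal_add (by norm_num) (by positivity)]
          apply ENNReal.ofReal_le_ofReal
          have : 1 ≤ (1 + h) ^ 2 := by nlinarith
          have h5 : 0 ≤ C₂ * (1 + h) ^ 2 := by positivity
          have h6 : 0 ≤ C₂ ^ 2 * (1 + h) ^ 2 := by positivity
          nlinarith
  calc _ ≤ (ENNReal.ofReal (((1 + C₂) * (1 + h)) ^ (2 : ℕ))) ^ (1 / 2 : ℝ) := by gcongr
    _ = ENNReal.ofReal (1 + C₂) * (1 + gagliardo β f) := by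
      rw [hG, ← ENNReal.ofReal_one, ← ENNReal.ofReal_add (by norm_num) hh0,
        ← ENNReal.ofReal_mul (by positivity), ENNReal.ofReal_rpow_of_nonneg (by positivity)
        (by norm_num), ← Real.sqrt_eq_rpow, Real.sqrt_sq (by positivity)]

/-! ### A quadrilinear Schur test -/

/-- The quadrilinear form
`∫ ∫ ∫ F(η) F(η + ξ) F(η') F(η' + ξ) K(ξ, η - η') dη' dη dξ`. -/
noncomputable def schurForm (K : ℝ → ℝ → ℝ≥0∞) (F : ℝ → ℝ≥0∞) : ℝ≥0∞ :=
  ∫⁻ ξ, ∫⁻ η, ∫⁻ η', F η * F (η + ξ) * (F η' * F (η' + ξ)) * K ξ (η - η')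

theorem mul_le_sq_add_sq (a b : ℝ≥0∞) : a * b ≤ a ^ 2 + b ^ 2 := by
  rcases le_total a b with h | h
  · exact le_trans (by rw [sq]; gcongr) le_add_self
  · exact le_trans (by rw [sq]; gcongr) le_self_add

theorem lintegral_mul_shift_le {F : ℝ → ℝ≥0∞} (hF : Measurable F) (hF1 : ∫⁻ x, F x ^ 2 ≤ 1)
    (a b : ℝ) : ∫⁻ x, F (x + a) * F (x + b) ≤ 2 := by
  calc ∫⁻ x, F (x + a) * F (x + b) ≤ ∫⁻ x, (F (x + a) ^ 2 + F (x + b) ^ 2) :=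
        lintegral_mono fun x => mul_le_sq_add_sq _ _
    _ = (∫⁻ x, F x ^ 2) + ∫⁻ x, F x ^ 2 := by
        rw [lintegral_add_left (by fun_prop), lintegral_add_right_eq_self (fun x => F x ^ 2) a,
          lintegral_add_right_eq_self (fun x => F x ^ 2) b]
    _ ≤ 1 + 1 := by gcongr
    _ = 2 := one_add_one_eq_two

/-- Schur test: a kernel that is integrable in the second variable, uniformly in the first. -/
theorem schurForm_le_of_lintegral_le {K : ℝ → ℝ → ℝ≥0∞} (hK : Measurable (Function.uncurry K))
    {C : ℝ≥0∞} (hC : ∀ ξ, ∫⁻ u, K ξ u ≤ C) {F : ℝ → ℝ≥0∞} (hF : Measurable F)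
    (hF1 : ∫⁻ x, F x ^ 2 ≤ 1) : schurForm K F ≤ 2 * C := by
  have key : ∀ ξ, ∫⁻ η, ∫⁻ η', F η * F (η + ξ) * (F η' * F (η' + ξ)) * K ξ (η - η') ≤
      2 * C * ∫⁻ η, F η ^ 2 * F (η + ξ) ^ 2 := by
    intro ξ
    have hKξ : Measurable (K ξ) := hK.comp measurable_prodMk_left
    have m1 : Measurable (fun z : ℝ × ℝ => (F z.1 * F (z.1 + ξ)) ^ 2 * K ξ (z.1 - z.2)) := by
      fun_prop
    have m2 : Measurable (fun z : ℝ × ℝ => (F z.2 * F (z.2 + ξ)) ^ 2 * K ξ (z.1 - z.2)) := by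
      fun_prop
    calc _ ≤ ∫⁻ η, ∫⁻ η', ((F η * F (η + ξ)) ^ 2 * K ξ (η - η') +
            (F η' * F (η' + ξ)) ^ 2 * K ξ (η - η')) := by
          refine lintegral_mono fun η => lintegral_mono fun η' => ?_
          simp only
          rw [← add_mul]
          gcongr
          exact mul_le_sq_add_sq _ _
      _ = (∫⁻ η, ∫⁻ η', (F η * F (η + ξ)) ^ 2 * K ξ (η - η')) +
            ∫⁻ η', ∫⁻ η, (F η' * F (η' + ξ)) ^ 2 * K ξ (η - η') := by
          rw [lintegral_lintegral_swap (f := fun η' η => (F η' * F (η' + ξ)) ^ 2 * K ξ (η - η'))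
            (by exact (m2.comp measurable_swap).aemeasurable), ← lintegral_add_left
            (by exact m1.lintegral_prod_right')]
          refine lintegral_congr fun η => ?_
          rw [lintegral_add_left (by fun_prop)]
      _ ≤ (∫⁻ η, (F η * F (η + ξ)) ^ 2 * C) + ∫⁻ η', (F η' * F (η' + ξ)) ^ 2 * C := by
          gcongr with η η'
          · rw [lintegral_const_mul _ (by fun_prop), lintegral_sub_left_eq_self (K ξ) η]
            gcongr
            exact hC ξ
          · rw [lintegral_const_mul _ (by fun_prop), lintegral_sub_right_eq_self (K ξ) η']
            gcongr
            exact hC ξ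
      _ = _ := by
          rw [lintegral_mul_const _ (by fun_prop), ← two_mul]
          simp only [mul_pow]
          ring
  have m3 : Measurable (fun z : ℝ × ℝ => F z.2 ^ 2 * F (z.2 + z.1) ^ 2) := by fun_prop
  calc schurForm K F ≤ ∫⁻ ξ, 2 * C * ∫⁻ η, F η ^ 2 * F (η + ξ) ^ 2 := lintegral_mono key
    _ = 2 * C * ∫⁻ η, ∫⁻ ξ, F η ^ 2 * F (η + ξ) ^ 2 := by
        rw [lintegral_const_mul _ (by exact m3.lintegral_prod_right'),
          lintegral_lintegral_swap (by exact m3.aemeasurable)]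
    _ = 2 * C * ((∫⁻ η, F η ^ 2) * ∫⁻ η, F η ^ 2) := by
        congr 1
        rw [← lintegral_mul_const _ (by fun_prop)]
        refine lintegral_congr fun η => ?_
        rw [lintegral_const_mul _ (by fun_prop), lintegral_add_left_eq_self (fun x => F x ^ 2) η]
    _ ≤ 2 * C * (1 * 1) := by gcongr
    _ = 2 * C := by ring

/-- Schur test: a kernel dominated by the sum of an integrable function of the first variable and
an integrable function of the second variable. -/
theorem schurForm_le_of_le_add {K : ℝ → ℝ → ℝ≥0∞} {k : ℝ → ℝ≥0∞} (hk : Measurable k)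
    (hKk : ∀ ξ u, K ξ u ≤ k ξ + k u) {F : ℝ → ℝ≥0∞} (hF : Measurable F)
    (hF1 : ∫⁻ x, F x ^ 2 ≤ 1) : schurForm K F ≤ 8 * ∫⁻ u, k u := by
  have h2 : ∀ a b, ∫⁻ x, F (x + a) * F (x + b) ≤ 2 := lintegral_mul_shift_le hF hF1
  have h2' : ∀ b, ∫⁻ x, F x * F (x + b) ≤ 2 := fun b => by simpa using h2 0 b
  have mA : Measurable (fun z : (ℝ × ℝ) × ℝ =>
      F z.1.2 * F (z.1.2 + z.1.1) * (F z.2 * F (z.2 + z.1.1)) * k z.1.1) := by fun_prop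
  have mB : Measurable (fun z : (ℝ × ℝ) × ℝ =>
      F z.1.2 * F (z.1.2 + z.1.1) * (F z.2 * F (z.2 + z.1.1)) * k (z.1.2 - z.2)) := by fun_prop
  have hA : ∫⁻ ξ, ∫⁻ η, ∫⁻ η', F η * F (η + ξ) * (F η' * F (η' + ξ)) * k ξ ≤
      4 * ∫⁻ u, k u := by
    rw [← lintegral_const_mul _ hk]
    refine lintegral_mono fun ξ => ?_
    calc _ = ∫⁻ η, F η * F (η + ξ) * ((∫⁻ η', F η' * F (η' + ξ)) * k ξ) := by
          refine lintegral_congr fun η => ?_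
          rw [← lintegral_mul_const _ (by fun_prop), ← lintegral_const_mul _ (by fun_prop)]
          simp only [mul_assoc]
      _ ≤ ∫⁻ η, F η * F (η + ξ) * (2 * k ξ) := by
          gcongr
          exact h2' ξ
      _ ≤ 2 * (2 * k ξ) := by
          rw [lintegral_mul_const _ (by fun_prop)]
          gcongr
          exact h2' ξ
      _ = 4 * k ξ := by ring
  have hB : ∫⁻ ξ, ∫⁻ η, ∫⁻ η', F η * F (η + ξ) * (F η' * F (η' + ξ)) * k (η - η') ≤
      4 * ∫⁻ u, k u := by
    calc _ = ∫⁻ η, ∫⁻ η', ∫⁻ ξ, F η * F (η + ξ) * (F η' * F (η' + ξ)) * k (η - η') := by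
          rw [lintegral_lintegral_swap (by exact mB.lintegral_prod_right'.aemeasurable)]
          refine lintegral_congr fun η => ?_
          rw [lintegral_lintegral_swap]
          fun_prop
      _ ≤ ∫⁻ η, ∫⁻ η', F η * F η' * k (η - η') * 2 := by
          gcongr with η η'
          calc _ = ∫⁻ ξ, F η * F η' * k (η - η') * (F (ξ + η) * F (ξ + η')) := by
                refine lintegral_congr fun ξ => ?_
                rw [add_comm ξ, add_comm ξ]
                ring
            _ ≤ _ := by
                rw [lintegral_const_mul _ (by fun_prop)]
                gcongr
                exact h2 _ _
      _ = ∫⁻ η, ∫⁻ u, F η * F (η - u) * k u * 2 := by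
          refine lintegral_congr fun η => ?_
          rw [← lintegral_sub_left_eq_self (fun u => F η * F (η - u) * k u * 2) η]
          simp
      _ = ∫⁻ u, (∫⁻ η, F (η + 0) * F (η + -u)) * (k u * 2) := by
          rw [lintegral_lintegral_swap (by fun_prop)]
          refine lintegral_congr fun u => ?_
          rw [← lintegral_mul_const _ (by fun_prop)]
          simp [mul_assoc, sub_eq_add_neg]
      _ ≤ ∫⁻ u, 2 * (k u * 2) := by
          gcongr with u
          exact h2 _ _
      _ = 4 * ∫⁻ u, k u := by
          rw [← lintegral_const_mul _ hk]
          refine lintegral_congr fun u => ?_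
          ring
  calc schurForm K F ≤ ∫⁻ ξ, ∫⁻ η, ∫⁻ η', (F η * F (η + ξ) * (F η' * F (η' + ξ)) * k ξ +
          F η * F (η + ξ) * (F η' * F (η' + ξ)) * k (η - η')) := by
        unfold schurForm
        gcongr with ξ η η'
        rw [← mul_add]
        gcongr
        exact hKk _ _
    _ = (∫⁻ ξ, ∫⁻ η, ∫⁻ η', F η * F (η + ξ) * (F η' * F (η' + ξ)) * k ξ) +
          ∫⁻ ξ, ∫⁻ η, ∫⁻ η', F η * F (η + ξ) * (F η' * F (η' + ξ)) * k (η - η') := by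
        rw [← lintegral_add_left (by
          exact mA.lintegral_prod_right'.lintegral_prod_right')]
        refine lintegral_congr fun ξ => ?_
        rw [← lintegral_add_left (by
          exact (mA.lintegral_prod_right').comp measurable_prodMk_left)]
        refine lintegral_congr fun η => ?_
        rw [lintegral_add_left (by fun_prop)]
    _ ≤ 4 * (∫⁻ u, k u) + 4 * ∫⁻ u, k u := add_le_add hA hB
    _ = 8 * ∫⁻ u, k u := by ring

/-- The kernel `|ξ|^β (1 + |ξ| |u|)^{-ρ}`. -/
noncomputable def irregularKernel (ρ β ξ u : ℝ) : ℝ≥0∞ :=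
  ENNReal.ofReal (|ξ| ^ β * (1 + |ξ| * |u|) ^ (-ρ))

theorem measurable_irregularKernel (ρ β : ℝ) :
    Measurable (Function.uncurry (irregularKernel ρ β)) := by
  unfold irregularKernel Function.uncurry
  fun_prop

theorem exists_lintegral_irregularKernel_le {ρ : ℝ} (hρ : 1 < ρ) :
    ∃ C : ℝ, 0 < C ∧ ∀ ξ, ∫⁻ u, irregularKernel ρ 1 ξ u ≤ ENNReal.ofReal C := by
  have hint : Integrable (fun x : ℝ => (1 + ‖x‖) ^ (-ρ)) :=
    integrable_one_add_norm (by simpa using hρ)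
  refine ⟨(∫ x : ℝ, (1 + ‖x‖) ^ (-ρ)) + 1,
    add_pos_of_nonneg_of_pos (integral_nonneg fun x => by positivity) one_pos, fun ξ => ?_⟩
  rcases eq_or_ne ξ 0 with rfl | hξ
  · simp [irregularKernel]
  have hint' : Integrable (fun u : ℝ => |ξ| ^ (1 : ℝ) * (1 + |ξ| * |u|) ^ (-ρ)) := by
    have := (hint.comp_mul_left' hξ).const_mul (|ξ| ^ (1 : ℝ))
    simpa [abs_mul] using this
  have heq : ∫ u : ℝ, |ξ| ^ (1 : ℝ) * (1 + |ξ| * |u|) ^ (-ρ) = ∫ x : ℝ, (1 + ‖x‖) ^ (-ρ) := by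
    have := Measure.integral_comp_mul_left (fun x : ℝ => (1 + ‖x‖) ^ (-ρ)) ξ
    simp only [Real.norm_eq_abs, abs_mul] at this ⊢
    rw [integral_const_mul, this, Real.rpow_one, smul_eq_mul, abs_inv, ← mul_assoc,
      mul_inv_cancel₀ (abs_ne_zero.2 hξ), one_mul]
  unfold irregularKernel
  rw [← ofReal_integral_eq_lintegral_ofReal hint' (Filter.Eventually.of_forall fun u => by
    positivity), heq]
  exact ENNReal.ofReal_le_ofReal (by linarith)

/-- The function that is `|x|^{-β}` near the origin and `|x|^{β - 2ρ}` away from it. It is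
integrable for `β < 1` and `β < 2ρ - 1`. For `β > 0` its value at the origin is `∞`, so that it
dominates the kernel there too. -/
noncomputable def irregularMajorant (ρ β x : ℝ) : ℝ≥0∞ :=
  if |x| ≤ 1 then ENNReal.ofReal |x| ^ (-β) else ENNReal.ofReal |x| ^ (β - 2 * ρ)

theorem measurable_irregularMajorant (ρ β : ℝ) : Measurable (irregularMajorant ρ β) := by
  unfold irregularMajorant
  refine Measurable.ite (measurableSet_le (by fun_prop) (by fun_prop)) ?_ ?_ <;> fun_prop

theorem irregularKernel_le_add {ρ β : ℝ} (hβ : 0 < β) (hβρ : β ≤ ρ) (ξ u : ℝ) :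
    irregularKernel ρ β ξ u ≤ irregularMajorant ρ β ξ + irregularMajorant ρ β u := by
  have hρ : 0 < ρ := hβ.trans_le hβρ
  have hξ0 : 0 ≤ |ξ| := abs_nonneg ξ
  have hu0 : 0 ≤ |u| := abs_nonneg u
  have hbase : 1 ≤ 1 + |ξ| * |u| := by nlinarith
  have hle1 : (1 + |ξ| * |u|) ^ (-ρ) ≤ 1 :=
    Real.rpow_le_one_of_one_le_of_nonpos hbase (by linarith)
  have hinv : ∀ {x : ℝ}, 0 < x → ∀ s : ℝ, ENNReal.ofReal x ^ s = ENNReal.ofReal (x ^ s) :=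
    fun hx s => ENNReal.ofReal_rpow_of_pos hx
  rcases le_or_gt |ξ| 1 with h1 | h1
  · refine le_trans ?_ le_self_add
    rw [irregularKernel, irregularMajorant, if_pos h1]
    have hone : 1 ≤ ENNReal.ofReal |ξ| ^ (-β) := by
      rw [ENNReal.rpow_neg, ENNReal.one_le_inv]
      exact ENNReal.rpow_le_one (ENNReal.ofReal_le_one.2 h1) hβ.le
    refine le_trans ?_ hone
    rw [ENNReal.ofReal_le_one]
    exact mul_le_one₀ (Real.rpow_le_one hξ0 h1 hβ.le) (by positivity) hle1
  have hξp : 0 < |ξ| := by linarith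
  rcases le_or_gt |u| 1 with h2 | h2
  · refine le_trans ?_ le_add_self
    rw [irregularKernel, irregularMajorant, if_pos h2]
    rcases hu0.eq_or_lt with h0 | hup
    · rw [← h0, ENNReal.ofReal_zero, ENNReal.zero_rpow_of_neg (by linarith)]
      exact le_top
    rw [hinv hup]
    apply ENNReal.ofReal_le_ofReal
    calc |ξ| ^ β * (1 + |ξ| * |u|) ^ (-ρ) ≤ |ξ| ^ β * (1 + |ξ| * |u|) ^ (-β) := by
          gcongr
      _ ≤ |ξ| ^ β * (|ξ| * |u|) ^ (-β) := by
          gcongr 1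
          exact Real.rpow_le_rpow_of_nonpos (by positivity) (by linarith) (by linarith)
      _ = |u| ^ (-β) := by
          rw [Real.mul_rpow hξ0 hu0, ← mul_assoc, ← Real.rpow_add hξp, add_neg_cancel,
            Real.rpow_zero, one_mul]
  have hup : 0 < |u| := by linarith
  have hK : |ξ| ^ β * (1 + |ξ| * |u|) ^ (-ρ) ≤ |ξ| ^ (β - ρ) * |u| ^ (-ρ) := by
    calc |ξ| ^ β * (1 + |ξ| * |u|) ^ (-ρ) ≤ |ξ| ^ β * (|ξ| * |u|) ^ (-ρ) := by
          gcongr 1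
          exact Real.rpow_le_rpow_of_nonpos (by positivity) (by linarith) (by linarith)
      _ = |ξ| ^ (β - ρ) * |u| ^ (-ρ) := by
          rw [Real.mul_rpow hξ0 hu0, ← mul_assoc, ← Real.rpow_add hξp, sub_eq_add_neg]
  rw [irregularKernel, irregularMajorant, irregularMajorant, if_neg h1.not_ge, if_neg h2.not_ge,
    hinv hξp, hinv hup]
  rcases le_total |ξ| |u| with h | h
  · refine le_trans (ENNReal.ofReal_le_ofReal (hK.trans ?_)) le_self_add
    calc |ξ| ^ (β - ρ) * |u| ^ (-ρ) ≤ |ξ| ^ (β - ρ) * |ξ| ^ (-ρ) := by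
          gcongr 1
          exact Real.rpow_le_rpow_of_nonpos hξp h (by linarith)
      _ = |ξ| ^ (β - 2 * ρ) := by
          rw [← Real.rpow_add hξp]
          ring_nf
  · refine le_trans (ENNReal.ofReal_le_ofReal (hK.trans ?_)) le_add_self
    calc |ξ| ^ (β - ρ) * |u| ^ (-ρ) ≤ |u| ^ (β - ρ) * |u| ^ (-ρ) := by
          gcongr 1
          exact Real.rpow_le_rpow_of_nonpos hup h (by linarith)
      _ = |u| ^ (β - 2 * ρ) := by
          rw [← Real.rpow_add hup]
          ring_nf

theorem lintegral_irregularMajorant_lt_top {ρ β : ℝ} (hβ1 : β < 1)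
    (hβρ : β < 2 * ρ - 1) : ∫⁻ x, irregularMajorant ρ β x < ∞ := by
  have hsymm : ∀ x, irregularMajorant ρ β (-x) = irregularMajorant ρ β x := fun x => by
    simp [irregularMajorant]
  have hhalf : ∫⁻ x in Ioi (0 : ℝ), irregularMajorant ρ β x < ∞ := by
    rw [← Ioc_union_Ioi_eq_Ioi (zero_le_one (α := ℝ))]
    refine (lintegral_union_le _ _ _).trans_lt (ENNReal.add_lt_top.2 ⟨?_, ?_⟩)
    · have h1 : IntegrableOn (fun x : ℝ => x ^ (-β)) (Ioc 0 1) := by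
        rw [← intervalIntegrable_iff_integrableOn_Ioc_of_le zero_le_one]
        exact intervalIntegral.intervalIntegrable_rpow' (by linarith)
      refine lt_of_eq_of_lt (setLIntegral_congr_fun measurableSet_Ioc fun x hx => ?_)
        h1.lintegral_lt_top
      rw [irregularMajorant, abs_of_pos hx.1, if_pos hx.2, ENNReal.ofReal_rpow_of_pos hx.1]
    · have h1 : IntegrableOn (fun x : ℝ => x ^ (β - 2 * ρ)) (Ioi 1) :=
        integrableOn_Ioi_rpow_of_lt (by linarith) one_pos
      refine lt_of_eq_of_lt (setLIntegral_congr_fun measurableSet_Ioi fun x hx => ?_)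
        h1.lintegral_lt_top
      have hx1 : (1 : ℝ) < x := hx
      have hx0 : 0 < x := by linarith
      rw [irregularMajorant, abs_of_pos hx0, if_neg hx1.not_ge, ENNReal.ofReal_rpow_of_pos hx0]
  have hneg : ∫⁻ x in Iic (0 : ℝ), irregularMajorant ρ β x =
      ∫⁻ x in Ioi (0 : ℝ), irregularMajorant ρ β x := by
    rw [← setLIntegral_congr (Iio_ae_eq_Iic (a := (0 : ℝ)))]
    have := (Measure.measurePreserving_neg (volume : Measure ℝ)).setLIntegral_comp_preimage
      (measurableSet_Ioi (a := (0 : ℝ))) (measurable_irregularMajorant ρ β)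
    simpa [hsymm] using this
  rw [← lintegral_add_compl _ (measurableSet_Ioi (a := (0 : ℝ))), compl_Ioi, hneg]
  exact ENNReal.add_lt_top.2 ⟨hhalf, hhalf⟩

/-- The quadrilinear estimate. For `ρ > 1` and `β = 1` the kernel is integrable in its second
variable, uniformly in the first; for `β < min 1 (2ρ - 1)` it splits as a sum of integrable
functions of one variable. -/
theorem exists_schurForm_irregularKernel_le {ρ β : ℝ}
    (h : (1 < ρ ∧ β = 1) ∨ (0 < β ∧ β < 1 ∧ β < 2 * ρ - 1 ∧ β ≤ ρ)) :
    ∃ C : ℝ, 0 < C ∧ ∀ F : ℝ → ℝ≥0∞, Measurable F → ∫⁻ x, F x ^ 2 ≤ 1 →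
      schurForm (irregularKernel ρ β) F ≤ ENNReal.ofReal C := by
  rcases h with ⟨hρ, rfl⟩ | ⟨hβ, hβ1, hβρ, hβρ'⟩
  · obtain ⟨C, hC, hCK⟩ := exists_lintegral_irregularKernel_le hρ
    refine ⟨2 * C, by positivity, fun F hF hF1 => ?_⟩
    have := schurForm_le_of_lintegral_le (measurable_irregularKernel ρ 1) hCK hF hF1
    rwa [ENNReal.ofReal_mul (by norm_num), ENNReal.ofReal_ofNat]
  · have hfin : 8 * ∫⁻ x, irregularMajorant ρ β x ≠ ∞ :=
      ENNReal.mul_ne_top (by simp) (lintegral_irregularMajorant_lt_top hβ1 hβρ).ne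
    refine ⟨(8 * ∫⁻ x, irregularMajorant ρ β x).toReal + 1, by positivity, fun F hF hF1 => ?_⟩
    refine (schurForm_le_of_le_add (measurable_irregularMajorant ρ β)
      (irregularKernel_le_add hβ hβρ') hF hF1).trans ?_
    rw [ENNReal.le_ofReal_iff_toReal_le hfin (by positivity)]
    linarith

open FourierTransform SchwartzMap ComplexConjugate

/-! ### Fourier analysis of densities -/

theorem hasTemperateGrowth_cexp_I_mul :
    (fun x : ℝ => Complex.exp (Complex.I * (x : ℂ))).HasTemperateGrowth := by
  refine ⟨(contDiff_const.mul Complex.ofRealCLM.contDiff).cexp, fun n => ⟨0, 1, fun x => ?_⟩⟩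
  rw [norm_iteratedFDeriv_eq_norm_iteratedDeriv]
  have h : ∀ n : ℕ, iteratedDeriv n (fun x : ℝ => Complex.exp (Complex.I * (x : ℂ))) =
      fun x : ℝ => Complex.I ^ n * Complex.exp (Complex.I * (x : ℂ)) := by
    intro n
    induction n with
    | zero => simp
    | succ k ih =>
      rw [iteratedDeriv_succ, ih]
      funext x
      have h1 : HasDerivAt (fun y : ℝ => Complex.I * (y : ℂ)) (Complex.I * 1) x :=
        (HasDerivAt.ofReal_comp (hasDerivAt_id x)).const_mul _
      rw [(h1.cexp.const_mul (Complex.I ^ k)).deriv]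
      ring
  rw [h n, norm_mul, norm_pow, Complex.norm_I, norm_exp_phase]
  simp

theorem hasTemperateGrowth_cexp_phase {θ : ℝ → ℝ} (hθ : θ.HasTemperateGrowth) :
    (fun ξ : ℝ => Complex.exp (Complex.I * (θ ξ : ℂ))).HasTemperateGrowth :=
  hasTemperateGrowth_cexp_I_mul.comp hθ

/-- Multiplication of a Schwartz function by `e^{iθ}`, for a phase `θ` of temperate growth. -/
noncomputable def phaseSchwartz (θ : ℝ → ℝ) (g : 𝓢(ℝ, ℂ)) : 𝓢(ℝ, ℂ) :=
  smulLeftCLM ℂ (fun ξ : ℝ => Complex.exp (Complex.I * (θ ξ : ℂ))) g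

theorem phaseSchwartz_apply {θ : ℝ → ℝ} (hθ : θ.HasTemperateGrowth) (g : 𝓢(ℝ, ℂ)) (ξ : ℝ) :
    phaseSchwartz θ g ξ = Complex.exp (Complex.I * (θ ξ : ℂ)) * g ξ := by
  rw [phaseSchwartz, smulLeftCLM_apply_apply (hasTemperateGrowth_cexp_phase hθ), smul_eq_mul]

theorem enorm_phaseSchwartz_apply {θ : ℝ → ℝ} (hθ : θ.HasTemperateGrowth) (g : 𝓢(ℝ, ℂ)) (ξ : ℝ) :
    ‖phaseSchwartz θ g ξ‖ₑ = ‖g ξ‖ₑ := by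
  rw [phaseSchwartz_apply hθ, ← ofReal_norm, ← ofReal_norm, norm_mul, norm_exp_phase, one_mul]

theorem integrable_norm_sq_schwartz (f : 𝓢(ℝ, ℂ)) : Integrable (fun x => ‖f x‖ ^ 2) :=
  (memLp_two_iff_integrable_sq_norm f.continuous.aestronglyMeasurable).1 (f.memLp 2)

/-- Plancherel's theorem for Schwartz functions, in terms of lower Lebesgue integrals. -/
theorem lintegral_enorm_sq_fourier (f : 𝓢(ℝ, ℂ)) :
    ∫⁻ ξ, ‖𝓕 f ξ‖ₑ ^ 2 = ∫⁻ x, ‖f x‖ₑ ^ 2 := by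
  have h : ∀ f : 𝓢(ℝ, ℂ), ∫⁻ x, ‖f x‖ₑ ^ 2 = ENNReal.ofReal (∫ x, ‖f x‖ ^ 2) := by
    intro f
    rw [ofReal_integral_eq_lintegral_ofReal (integrable_norm_sq_schwartz f)
      (Filter.Eventually.of_forall fun x => by positivity)]
    refine lintegral_congr fun x => ?_
    rw [← ofReal_norm, ENNReal.ofReal_pow (norm_nonneg _)]
  rw [h, h, integral_norm_sq_fourier]

theorem lintegral_increment_sq_eq (f : 𝓢(ℝ, ℂ)) (y : ℝ) :
    ∫⁻ x, ‖f x - f (x + y)‖ₑ ^ 2 =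
      ∫⁻ ξ, ‖Complex.exp (Complex.I * ((2 * Real.pi * y * ξ : ℝ) : ℂ)) - 1‖ₑ ^ 2 *
        ‖𝓕 f ξ‖ₑ ^ 2 := by
  have hθ : (fun ξ : ℝ => 2 * Real.pi * y * ξ).HasTemperateGrowth := by fun_prop
  -- the increment is the inverse transform of `(1 - e^{2πiyξ}) 𝓕 f`
  set h : 𝓢(ℝ, ℂ) := 𝓕 f - phaseSchwartz (fun ξ : ℝ => 2 * Real.pi * y * ξ) (𝓕 f) with hh
  have hf : 𝓕⁻ (𝓕 f) = f := FourierTransform.fourierInv_fourier_eq f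
  have hshift : ∀ x, 𝓕⁻ (phaseSchwartz (fun ξ : ℝ => 2 * Real.pi * y * ξ) (𝓕 f)) x =
      f (x + y) := by
    intro x
    conv_rhs => rw [← hf]
    rw [SchwartzMap.fourierInv_coe, SchwartzMap.fourierInv_coe, Real.fourierInv_eq',
      Real.fourierInv_eq']
    refine integral_congr_ae (Filter.Eventually.of_forall fun ξ => ?_)
    simp only [phaseSchwartz_apply hθ, smul_eq_mul]
    rw [← mul_assoc, ← Complex.exp_add]
    congr 2
    simp
    ring
  have hinc : ∀ x, (𝓕⁻ h) x = f x - f (x + y) := by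
    intro x
    have : 𝓕⁻ h = 𝓕⁻ (𝓕 f) - 𝓕⁻ (phaseSchwartz (fun ξ : ℝ => 2 * Real.pi * y * ξ) (𝓕 f)) :=
      map_sub (fourierInvCLM ℂ 𝓢(ℝ, ℂ)) _ _
    rw [this, sub_apply, hshift, hf]
  calc ∫⁻ x, ‖f x - f (x + y)‖ₑ ^ 2 = ∫⁻ x, ‖(𝓕⁻ h) x‖ₑ ^ 2 := by simp only [hinc]
    _ = ∫⁻ ξ, ‖h ξ‖ₑ ^ 2 := by
      rw [← lintegral_enorm_sq_fourier, FourierTransform.fourier_fourierInv_eq]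
    _ = _ := by
      refine lintegral_congr fun ξ => ?_
      rw [hh, sub_apply, phaseSchwartz_apply hθ, ← mul_pow, ← enorm_mul, ← enorm_neg]
      congr 2
      ring

/-- The symbol of the squared Gagliardo seminorm is `O(|ξ|^β)`: the integral over `y ≤ 1 / |ξ|` is
controlled by `|e^{iθ} - 1| ≤ |θ|`, and the integral over `y > 1 / |ξ|` by `|e^{iθ} - 1| ≤ 2`. -/
theorem exists_lintegral_symbol_le {β : ℝ} (hβ : 0 < β) (hβ1 : β ≤ 1) :
    ∃ c : ℝ, 0 < c ∧ ∀ ξ : ℝ, ∫⁻ y in Ioi (0 : ℝ),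
      ‖Complex.exp (Complex.I * ((2 * Real.pi * y * ξ : ℝ) : ℂ)) - 1‖ₑ ^ 2 *
        ENNReal.ofReal (y ^ (-1 - β)) ≤ ENNReal.ofReal (c * |ξ| ^ β) := by
  set c₁ : ℝ := (2 * Real.pi) ^ 2 / (2 - β) with hc₁
  have hc₁p : 0 < c₁ := div_pos (by positivity) (by linarith)
  refine ⟨c₁ + 4 / β, by positivity, fun ξ => ?_⟩
  rcases eq_or_ne ξ 0 with rfl | hξ
  · simp
  have hξ0 : 0 < |ξ| := abs_pos.2 hξ
  set r : ℝ := |ξ|⁻¹ with hr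
  have hr0 : 0 < r := by positivity
  have hnorm : ∀ y : ℝ, ∀ B : ℝ, 0 ≤ B →
      ‖Complex.exp (Complex.I * ((2 * Real.pi * y * ξ : ℝ) : ℂ)) - 1‖ ≤ B →
      ‖Complex.exp (Complex.I * ((2 * Real.pi * y * ξ : ℝ) : ℂ)) - 1‖ₑ ^ 2 *
        ENNReal.ofReal (y ^ (-1 - β)) ≤ ENNReal.ofReal (B ^ 2 * y ^ (-1 - β)) := by
    intro y B hB h
    rw [ENNReal.ofReal_mul (by positivity), ← ofReal_norm, ← ENNReal.ofReal_pow (norm_nonneg _)]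
    gcongr
  have hnear : ∫⁻ y in Ioc 0 r,
      ‖Complex.exp (Complex.I * ((2 * Real.pi * y * ξ : ℝ) : ℂ)) - 1‖ₑ ^ 2 *
        ENNReal.ofReal (y ^ (-1 - β)) ≤ ENNReal.ofReal (c₁ * |ξ| ^ β) := by
    have hi : IntegrableOn (fun y : ℝ => (2 * Real.pi) ^ 2 * |ξ| ^ 2 * y ^ (1 - β)) (Ioc 0 r) := by
      rw [← intervalIntegrable_iff_integrableOn_Ioc_of_le hr0.le]
      exact (intervalIntegral.intervalIntegrable_rpow' (by linarith)).const_mul _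
    calc _ ≤ ∫⁻ y in Ioc 0 r, ENNReal.ofReal ((2 * Real.pi) ^ 2 * |ξ| ^ 2 * y ^ (1 - β)) := by
          refine setLIntegral_mono' measurableSet_Ioc fun y hy => ?_
          have hb : ‖Complex.exp (Complex.I * ((2 * Real.pi * y * ξ : ℝ) : ℂ)) - 1‖ ≤
              2 * Real.pi * y * |ξ| := by
            refine Real.norm_exp_I_mul_ofReal_sub_one_le.trans (le_of_eq ?_)
            rw [Real.norm_eq_abs, abs_mul, abs_of_nonneg (by have := hy.1; positivity)]
          refine (hnorm y _ (by have := hy.1; positivity) hb).trans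
            (ENNReal.ofReal_le_ofReal (le_of_eq ?_))
          have : y ^ (1 - β) = y ^ 2 * y ^ (-1 - β) := by
            rw [← Real.rpow_two, ← Real.rpow_add hy.1]
            ring_nf
          rw [this]
          ring
      _ = ENNReal.ofReal (∫ y in (0 : ℝ)..r, (2 * Real.pi) ^ 2 * |ξ| ^ 2 * y ^ (1 - β)) := by
          rw [intervalIntegral.integral_of_le hr0.le, ofReal_integral_eq_lintegral_ofReal hi]
          filter_upwards [ae_restrict_mem measurableSet_Ioc] with y hy
          have := hy.1
          positivity
      _ = _ := by
          rw [intervalIntegral.integral_const_mul, integral_rpow (Or.inl (by linarith)),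
            Real.zero_rpow (by linarith), sub_zero]
          congr 1
          have e1 : 1 - β + 1 = 2 - β := by ring
          have e2 : r ^ (2 - β) = (|ξ| ^ 2)⁻¹ * |ξ| ^ β := by
            rw [hr, Real.inv_rpow hξ0.le, Real.rpow_sub hξ0, Real.rpow_two, inv_div, div_eq_mul_inv,
              mul_comm]
          rw [e1, e2, hc₁]
          field_simp
  have hfar : ∫⁻ y in Ioi r,
      ‖Complex.exp (Complex.I * ((2 * Real.pi * y * ξ : ℝ) : ℂ)) - 1‖ₑ ^ 2 *
        ENNReal.ofReal (y ^ (-1 - β)) ≤ ENNReal.ofReal (4 / β * |ξ| ^ β) := by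
    have hi : IntegrableOn (fun y : ℝ => 2 ^ 2 * y ^ (-1 - β)) (Ioi r) :=
      (integrableOn_Ioi_rpow_of_lt (by linarith) hr0).const_mul _
    calc _ ≤ ∫⁻ y in Ioi r, ENNReal.ofReal (2 ^ 2 * y ^ (-1 - β)) := by
          refine setLIntegral_mono' measurableSet_Ioi fun y hy => ?_
          refine hnorm y 2 (by norm_num) ((norm_sub_le _ _).trans ?_)
          rw [norm_exp_phase, norm_one]
          norm_num
      _ = ENNReal.ofReal (∫ y in Ioi r, 2 ^ 2 * y ^ (-1 - β)) := by
          rw [ofReal_integral_eq_lintegral_ofReal hi]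
          filter_upwards [ae_restrict_mem measurableSet_Ioi] with y hy
          have : 0 < y := hr0.trans hy
          positivity
      _ = _ := by
          rw [integral_const_mul, integral_Ioi_rpow_of_lt (by linarith) hr0]
          congr 1
          have e1 : -1 - β + 1 = -β := by ring
          rw [e1, hr, Real.inv_rpow hξ0.le, Real.rpow_neg hξ0.le, inv_inv]
          field_simp
          norm_num
  rw [← Ioc_union_Ioi_eq_Ioi hr0.le, add_mul, ENNReal.ofReal_add (by positivity) (by positivity)]
  exact (lintegral_union_le _ _ _).trans (add_le_add hnear hfar)

/-- The Gagliardo seminorm of order `β / 2` is controlled by the `Ḣ^{β/2}` norm. -/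
theorem exists_gagliardo_le {β : ℝ} (hβ : 0 < β) (hβ1 : β ≤ 1) :
    ∃ c : ℝ, 0 < c ∧ ∀ f : 𝓢(ℝ, ℂ), gagliardo β f ≤
      ENNReal.ofReal c * ∫⁻ ξ, ENNReal.ofReal (|ξ| ^ β) * ‖𝓕 f ξ‖ₑ ^ 2 := by
  obtain ⟨c, hc, hcξ⟩ := exists_lintegral_symbol_le hβ hβ1
  refine ⟨c, hc, fun f => ?_⟩
  have hfm : Measurable f := f.continuous.measurable
  have hFm : Measurable (𝓕 f : 𝓢(ℝ, ℂ)) := (𝓕 f).continuous.measurable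
  calc gagliardo β f
      = ∫⁻ y in Ioi (0 : ℝ), ∫⁻ x, ‖f x - f (x + y)‖ₑ ^ 2 * ENNReal.ofReal (y ^ (-1 - β)) := by
        rw [gagliardo, lintegral_lintegral_swap]
        exact Measurable.aemeasurable (by fun_prop)
    _ = ∫⁻ y in Ioi (0 : ℝ), ∫⁻ ξ,
          ‖Complex.exp (Complex.I * ((2 * Real.pi * y * ξ : ℝ) : ℂ)) - 1‖ₑ ^ 2 *
            ENNReal.ofReal (y ^ (-1 - β)) * ‖𝓕 f ξ‖ₑ ^ 2 := by
        refine lintegral_congr fun y => ?_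
        rw [lintegral_mul_const _ (by fun_prop), lintegral_increment_sq_eq,
          ← lintegral_mul_const _ (by fun_prop)]
        refine lintegral_congr fun ξ => ?_
        ring
    _ = ∫⁻ ξ, (∫⁻ y in Ioi (0 : ℝ),
          ‖Complex.exp (Complex.I * ((2 * Real.pi * y * ξ : ℝ) : ℂ)) - 1‖ₑ ^ 2 *
            ENNReal.ofReal (y ^ (-1 - β))) * ‖𝓕 f ξ‖ₑ ^ 2 := by
        rw [lintegral_lintegral_swap (Measurable.aemeasurable (by fun_prop))]
        refine lintegral_congr fun ξ => ?_
        rw [lintegral_mul_const _ (by fun_prop)]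
    _ ≤ ∫⁻ ξ, ENNReal.ofReal (c * |ξ| ^ β) * ‖𝓕 f ξ‖ₑ ^ 2 := by
        gcongr with ξ
        exact hcξ ξ
    _ = _ := by
        rw [← lintegral_const_mul _ (by fun_prop)]
        refine lintegral_congr fun ξ => ?_
        rw [ENNReal.ofReal_mul hc.le, mul_assoc]

/-- The density `|u|²` of a Schwartz function, as a complex Schwartz function. -/
noncomputable def density (u : 𝓢(ℝ, ℂ)) : 𝓢(ℝ, ℂ) :=
  pairing (ContinuousLinearMap.mul ℝ ℂ) u
    (postcompCLM (Complex.conjCLE : ℂ →L[ℝ] ℂ) u)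

theorem density_apply (u : 𝓢(ℝ, ℂ)) (x : ℝ) : density u x = u x * conj (u x) := by
  simp [density, pairing_apply_apply]

theorem enorm_density_apply (u : 𝓢(ℝ, ℂ)) (x : ℝ) : ‖density u x‖ₑ = ‖u x‖ₑ ^ 2 := by
  rw [density_apply, enorm_mul, sq]
  congr 1
  rw [← ofReal_norm, RCLike.norm_conj, ofReal_norm]

/-- The Fourier transform of `|u|²` is the autocorrelation of the Fourier transform of `u`. -/
theorem fourier_density_apply (m : 𝓢(ℝ, ℂ)) (ξ : ℝ) :
    𝓕 (density (𝓕⁻ m)) ξ = ∫ η, conj (m η) * m (η + ξ) := by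
  set u : 𝓢(ℝ, ℂ) := 𝓕⁻ m with hu
  have hm : 𝓕 u = m := FourierTransform.fourier_fourierInv_eq m
  have hθ : (fun x : ℝ => -(2 * Real.pi * ξ) * x).HasTemperateGrowth := by fun_prop
  -- the modulation `e^{-2πixξ} u` has the Fourier transform `η ↦ m (η + ξ)`
  have hshift : ∀ η, 𝓕 (phaseSchwartz (fun x : ℝ => -(2 * Real.pi * ξ) * x) u) η =
      m (η + ξ) := by
    intro η
    rw [← hm, SchwartzMap.fourier_coe, SchwartzMap.fourier_coe, Real.fourier_eq',
      Real.fourier_eq']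
    refine integral_congr_ae (Filter.Eventually.of_forall fun x => ?_)
    simp only [phaseSchwartz_apply hθ, smul_eq_mul]
    rw [← mul_assoc, ← Complex.exp_add]
    congr 2
    simp
    ring
  have hP := integral_inner_fourier_fourier u
    (phaseSchwartz (fun x : ℝ => -(2 * Real.pi * ξ) * x) u)
  simp only [hm, hshift, RCLike.inner_apply', phaseSchwartz_apply hθ] at hP
  rw [hP, SchwartzMap.fourier_coe, Real.fourier_eq']
  refine integral_congr_ae (Filter.Eventually.of_forall fun x => ?_)
  simp only [density_apply, smul_eq_mul]
  have : Complex.exp (((-2 * Real.pi * inner ℝ x ξ : ℝ) : ℂ) * Complex.I) =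
      Complex.exp (Complex.I * ((-(2 * Real.pi * ξ) * x : ℝ) : ℂ)) := by
    congr 1
    simp
    ring
  rw [this]
  ring

/-! ### Averaging in time against an irregular path -/

/-- The square of an oscillatory integral with phase `w_t θ(η)`, integrated in time, is a double
integral against the Fourier transform of the occupation measure of `w`. -/
theorem setLIntegral_enorm_sq_oscillatory_le {w θ : ℝ → ℝ} (hw : Continuous w) (hθ : Continuous θ)
    {G : ℝ → ℂ} (hG : Integrable G) {τ : ℝ} (hτ : 0 ≤ τ) :
    ∫⁻ t in Icc 0 τ, ‖∫ η, Complex.exp (Complex.I * ((w t * θ η : ℝ) : ℂ)) * G η‖ₑ ^ 2 ≤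
      ∫⁻ η, ∫⁻ η', ‖G η‖ₑ * ‖G η'‖ₑ * ‖occupationFourier w 0 τ (θ η - θ η')‖ₑ := by
  set S : ℝ → ℂ := fun t => ∫ η, Complex.exp (Complex.I * ((w t * θ η : ℝ) : ℂ)) * G η with hS
  set μ : Measure ℝ := volume.restrict (Icc 0 τ) with hμ
  set H : ℝ × ℝ → ℂ := fun z => G z.1 * conj (G z.2) with hH
  have hGc : Integrable (fun η => conj (G η)) :=
    (LinearIsometryEquiv.integrable_comp_iff (L := Complex.conjLIE) (φ := G)).2 hG
  have hHint : Integrable H (volume.prod volume) := hG.mul_prod hGc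
  set Φ : ℝ × (ℝ × ℝ) → ℂ := fun z =>
    Complex.exp (Complex.I * (((θ z.2.1 - θ z.2.2) * w z.1 : ℝ) : ℂ)) * H z.2 with hΦ
  have hΦint : Integrable Φ (μ.prod (volume.prod volume)) := by
    refine (hHint.comp_snd μ).bdd_mul (c := 1)
      (Continuous.aestronglyMeasurable (by fun_prop)) ?_
    exact Filter.Eventually.of_forall fun z => (norm_exp_phase _).le
  have hsq : ∀ t, ∫ z, Φ (t, z) ∂(volume.prod volume) = ((‖S t‖ ^ 2 : ℝ) : ℂ) := by
    intro t
    have h1 : ∀ z : ℝ × ℝ, Φ (t, z) =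
        (Complex.exp (Complex.I * ((w t * θ z.1 : ℝ) : ℂ)) * G z.1) *
          conj (Complex.exp (Complex.I * ((w t * θ z.2 : ℝ) : ℂ)) * G z.2) := by
      intro z
      have h2 : conj (Complex.exp (Complex.I * ((w t * θ z.2 : ℝ) : ℂ))) =
          Complex.exp (-(Complex.I * ((w t * θ z.2 : ℝ) : ℂ))) := by
        rw [← Complex.exp_conj]
        simp
      simp only [hΦ, hH, map_mul (starRingEnd ℂ)]
      rw [h2]
      have h3 : Complex.exp (Complex.I * (((θ z.1 - θ z.2) * w t : ℝ) : ℂ)) =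
          Complex.exp (Complex.I * ((w t * θ z.1 : ℝ) : ℂ)) *
            Complex.exp (-(Complex.I * ((w t * θ z.2 : ℝ) : ℂ))) := by
        rw [← Complex.exp_add]
        congr 1
        push_cast
        ring
      rw [h3]
      ring
    simp only [h1]
    rw [integral_prod_mul (fun η => Complex.exp (Complex.I * ((w t * θ η : ℝ) : ℂ)) * G η)
      (fun η => conj (Complex.exp (Complex.I * ((w t * θ η : ℝ) : ℂ)) * G η)), integral_conj]
    rw [Complex.mul_conj, Complex.normSq_eq_norm_sq]
  have hocc : ∀ z : ℝ × ℝ, ∫ t, Φ (t, z) ∂μ = occupationFourier w 0 τ (θ z.1 - θ z.2) * H z := by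
    intro z
    rw [occupationFourier, intervalIntegral.integral_of_le hτ, ← integral_Icc_eq_integral_Ioc,
      ← integral_mul_const]
  have hSint : Integrable (fun t => ((‖S t‖ ^ 2 : ℝ) : ℂ)) μ := by
    have := hΦint.integral_prod_left
    simpa only [hsq] using this
  have hSint' : Integrable (fun t => ‖S t‖ ^ 2) μ := by
    exact hSint.re
  calc ∫⁻ t in Icc 0 τ, ‖S t‖ₑ ^ 2 = ENNReal.ofReal (∫ t, ‖S t‖ ^ 2 ∂μ) := by
        rw [ofReal_integral_eq_lintegral_ofReal hSint'
          (Filter.Eventually.of_forall fun t => by positivity)]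
        refine lintegral_congr fun t => ?_
        rw [← ofReal_norm, ENNReal.ofReal_pow (norm_nonneg _)]
    _ ≤ ‖∫ t, ((‖S t‖ ^ 2 : ℝ) : ℂ) ∂μ‖ₑ := by
        rw [integral_complex_ofReal, ← ofReal_norm, Complex.norm_real]
        exact ENNReal.ofReal_le_ofReal (le_abs_self _)
    _ = ‖∫ z, occupationFourier w 0 τ (θ z.1 - θ z.2) * H z ∂(volume.prod volume)‖ₑ := by
        simp only [← hsq, ← hocc]
        rw [integral_integral_swap (f := fun t z => Φ (t, z)) hΦint]
    _ ≤ ∫⁻ z, ‖occupationFourier w 0 τ (θ z.1 - θ z.2) * H z‖ₑ ∂(volume.prod volume) :=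
        enorm_integral_le_lintegral_enorm _
    _ = ∫⁻ η, ∫⁻ η', ‖occupationFourier w 0 τ (θ η - θ η') * H (η, η')‖ₑ := by
        refine lintegral_prod _ ?_
        have : AEStronglyMeasurable (fun z => ∫ t, Φ (t, z) ∂μ) (volume.prod volume) :=
          hΦint.aestronglyMeasurable.prod_swap.integral_prod_right'
        simp only [hocc] at this
        exact this.enorm
    _ = _ := by
        refine lintegral_congr fun η => lintegral_congr fun η' => ?_
        rw [enorm_mul, mul_comm, enorm_mul]
        congr 2
        rw [← ofReal_norm, RCLike.norm_conj, ofReal_norm]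

/-- The solution `e^{i a ∂²} φ` at dispersion time `a` for the datum `φ` with Fourier transform
`g`. -/
noncomputable def schwartzFlow (a : ℝ) (g : 𝓢(ℝ, ℂ)) : 𝓢(ℝ, ℂ) :=
  𝓕⁻ (phaseSchwartz (fun ξ => -a * (2 * Real.pi * ξ) ^ 2) g)

theorem hasTemperateGrowth_schrodingerPhase (a : ℝ) :
    (fun ξ : ℝ => -a * (2 * Real.pi * ξ) ^ 2).HasTemperateGrowth := by
  fun_prop

theorem lintegral_enorm_sq_schwartzFlow (a : ℝ) (g : 𝓢(ℝ, ℂ)) :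
    ∫⁻ x, ‖schwartzFlow a g x‖ₑ ^ 2 = ∫⁻ ξ, ‖g ξ‖ₑ ^ 2 := by
  rw [← lintegral_enorm_sq_fourier, schwartzFlow, FourierTransform.fourier_fourierInv_eq]
  simp only [enorm_phaseSchwartz_apply (hasTemperateGrowth_schrodingerPhase a)]

/-- In the autocorrelation of the Fourier transform of the solution the quadratic phases combine to
a phase that is affine in the frequency. -/
theorem fourier_density_schwartzFlow (a : ℝ) (g : 𝓢(ℝ, ℂ)) (ξ : ℝ) :
    𝓕 (density (schwartzFlow a g)) ξ =
      ∫ η, Complex.exp (Complex.I * ((a * (-(4 * Real.pi ^ 2 * ξ * (2 * η + ξ))) : ℝ) : ℂ)) *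
        (conj (g η) * g (η + ξ)) := by
  rw [schwartzFlow, fourier_density_apply]
  refine integral_congr_ae (Filter.Eventually.of_forall fun η => ?_)
  simp only [phaseSchwartz_apply (hasTemperateGrowth_schrodingerPhase a), map_mul]
  have h2 : conj (Complex.exp (Complex.I * ((-a * (2 * Real.pi * η) ^ 2 : ℝ) : ℂ))) =
      Complex.exp (-(Complex.I * ((-a * (2 * Real.pi * η) ^ 2 : ℝ) : ℂ))) := by
    rw [← Complex.exp_conj, map_mul, Complex.conj_I, Complex.conj_ofReal, neg_mul]
  have h3 : Complex.exp (Complex.I * ((a * (-(4 * Real.pi ^ 2 * ξ * (2 * η + ξ))) : ℝ) : ℂ)) =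
      Complex.exp (-(Complex.I * ((-a * (2 * Real.pi * η) ^ 2 : ℝ) : ℂ))) *
        Complex.exp (Complex.I * ((-a * (2 * Real.pi * (η + ξ)) ^ 2 : ℝ) : ℂ)) := by
    rw [← Complex.exp_add]
    congr 1
    push_cast
    ring
  rw [h2, h3]
  ring

/-- The bilinear smoothing estimate: averaging in time along an irregular path gains `β / 2`
derivatives on the density of a solution. -/
theorem setLIntegral_fourier_density_le {w : ℝ → ℝ} (hw : Continuous w) {τ M ρ β : ℝ}
    (hτ : 0 ≤ τ) (hM : 0 ≤ M) (hρ : 0 < ρ)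
    (hΦ : ∀ a, ‖occupationFourier w 0 τ a‖ ≤ M * (1 + |a|) ^ (-ρ)) (g : 𝓢(ℝ, ℂ)) :
    ∫⁻ t in Icc 0 τ, ∫⁻ ξ, ENNReal.ofReal (|ξ| ^ β) *
        ‖𝓕 (density (schwartzFlow (w t) g)) ξ‖ₑ ^ 2 ≤
      ENNReal.ofReal M * schurForm (irregularKernel ρ β) (fun ξ => ‖g ξ‖ₑ) := by
  have hgm : Measurable g := g.continuous.measurable
  have hgc : Continuous g := g.continuous
  have hmeas : Measurable fun z : ℝ × ℝ => 𝓕 (density (schwartzFlow (w z.1) g)) z.2 := by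
    simp only [fourier_density_schwartzFlow]
    refine (StronglyMeasurable.integral_prod_right' (f := fun z : (ℝ × ℝ) × ℝ =>
      Complex.exp (Complex.I *
        ((w z.1.1 * (-(4 * Real.pi ^ 2 * z.1.2 * (2 * z.2 + z.1.2))) : ℝ) : ℂ)) *
        (conj (g z.2) * g (z.2 + z.1.2))) ?_).measurable
    refine Continuous.stronglyMeasurable ?_
    have : Continuous fun z : (ℝ × ℝ) × ℝ => conj (g z.2) :=
      Complex.continuous_conj.comp (hgc.comp continuous_snd)
    fun_prop
  rw [lintegral_lintegral_swap (by fun_prop), schurForm,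
    ← lintegral_const_mul' _ _ ENNReal.ofReal_ne_top]
  refine lintegral_mono fun ξ => ?_
  have hGint : Integrable (fun η => conj (g η) * g (η + ξ)) := by
    refine (g.integrable.comp_add_right ξ).bdd_mul (c := (SchwartzMap.seminorm ℝ 0 0) g)
      (Complex.continuous_conj.comp hgc).aestronglyMeasurable ?_
    exact Filter.Eventually.of_forall fun η => by
      rw [RCLike.norm_conj]
      exact norm_le_seminorm ℝ g η
  have hosc := setLIntegral_enorm_sq_oscillatory_le hw
    (θ := fun η => -(4 * Real.pi ^ 2 * ξ * (2 * η + ξ))) (by fun_prop) hGint hτ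
  calc ∫⁻ t in Icc 0 τ, ENNReal.ofReal (|ξ| ^ β) *
        ‖𝓕 (density (schwartzFlow (w t) g)) ξ‖ₑ ^ 2
      = ENNReal.ofReal (|ξ| ^ β) * ∫⁻ t in Icc 0 τ,
        ‖𝓕 (density (schwartzFlow (w t) g)) ξ‖ₑ ^ 2 :=
        lintegral_const_mul' _ _ ENNReal.ofReal_ne_top
    _ ≤ ENNReal.ofReal (|ξ| ^ β) * ∫⁻ η, ∫⁻ η', ‖conj (g η) * g (η + ξ)‖ₑ *
          ‖conj (g η') * g (η' + ξ)‖ₑ *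
          ‖occupationFourier w 0 τ (-(4 * Real.pi ^ 2 * ξ * (2 * η + ξ)) -
            -(4 * Real.pi ^ 2 * ξ * (2 * η' + ξ)))‖ₑ := by
        refine mul_le_mul_right ?_ _
        simp only [fourier_density_schwartzFlow]
        exact hosc
    _ ≤ _ := by
        rw [← lintegral_const_mul' _ _ ENNReal.ofReal_ne_top,
          ← lintegral_const_mul' _ _ ENNReal.ofReal_ne_top]
        refine lintegral_mono fun η => ?_
        rw [← lintegral_const_mul' _ _ ENNReal.ofReal_ne_top,
          ← lintegral_const_mul' _ _ ENNReal.ofReal_ne_top]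
        refine lintegral_mono fun η' => ?_
        have hconj : ∀ x, ‖conj (g x)‖ₑ = ‖g x‖ₑ := fun x => by
          rw [← ofReal_norm, RCLike.norm_conj, ofReal_norm]
        have habs : |ξ| * |η - η'| ≤ |-(4 * Real.pi ^ 2 * ξ * (2 * η + ξ)) -
            -(4 * Real.pi ^ 2 * ξ * (2 * η' + ξ))| := by
          have : -(4 * Real.pi ^ 2 * ξ * (2 * η + ξ)) - -(4 * Real.pi ^ 2 * ξ * (2 * η' + ξ)) =
              -(8 * Real.pi ^ 2) * (ξ * (η - η')) := by ring
          rw [this, abs_mul, abs_mul ξ, abs_neg,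
            abs_of_pos (show (0 : ℝ) < 8 * Real.pi ^ 2 by positivity)]
          have hpi : 1 ≤ 8 * Real.pi ^ 2 := by nlinarith [Real.pi_gt_three]
          have : 0 ≤ |ξ| * |η - η'| := by positivity
          nlinarith
        have hocc : ‖occupationFourier w 0 τ (-(4 * Real.pi ^ 2 * ξ * (2 * η + ξ)) -
            -(4 * Real.pi ^ 2 * ξ * (2 * η' + ξ)))‖ₑ ≤
            ENNReal.ofReal M * ENNReal.ofReal ((1 + |ξ| * |η - η'|) ^ (-ρ)) := by
          rw [← ofReal_norm, ← ENNReal.ofReal_mul hM]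
          refine ENNReal.ofReal_le_ofReal ((hΦ _).trans ?_)
          gcongr 1
          exact Real.rpow_le_rpow_of_nonpos (by positivity) (by linarith) (by linarith)
        rw [enorm_mul, enorm_mul, hconj, hconj, irregularKernel,
          ENNReal.ofReal_mul (by positivity)]
        calc _ ≤ ENNReal.ofReal (|ξ| ^ β) * (‖g η‖ₑ * ‖g (η + ξ)‖ₑ * (‖g η'‖ₑ * ‖g (η' + ξ)‖ₑ) *
              (ENNReal.ofReal M * ENNReal.ofReal ((1 + |ξ| * |η - η'|) ^ (-ρ)))) := by
              gcongr
          _ = _ := by ring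

/-- The homogeneous Strichartz estimate for a normalised Schwartz datum. -/
theorem exists_setLIntegral_schwartzFlow_le {p ρ β : ℝ} (hp : 1 ≤ p) (hρ : 0 < ρ) (hβ : 0 < β)
    (hβ1 : β ≤ 1) (hpβ : p ≤ 2 + (2 + β) * β)
    (h : (1 < ρ ∧ β = 1) ∨ (0 < β ∧ β < 1 ∧ β < 2 * ρ - 1 ∧ β ≤ ρ)) :
    ∃ C : ℝ, 0 < C ∧ ∀ (w : ℝ → ℝ) (τ M : ℝ), Continuous w → 0 ≤ τ → 0 ≤ M →
      (∀ a, ‖occupationFourier w 0 τ a‖ ≤ M * (1 + |a|) ^ (-ρ)) →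
      ∀ g : 𝓢(ℝ, ℂ), ∫⁻ ξ, ‖g ξ‖ₑ ^ 2 ≤ 1 →
        ∫⁻ t in Icc 0 τ, (∫⁻ x, ‖schwartzFlow (w t) g x‖ₑ ^ (2 * p)) ^ (1 / 2 : ℝ) ≤
          ENNReal.ofReal (C * (τ + M)) := by
  obtain ⟨C₁, hC₁, hsob⟩ := exists_lintegral_rpow_rpow_half_le hp hβ hβ1 hpβ
  obtain ⟨c, hc, hgag⟩ := exists_gagliardo_le hβ hβ1
  obtain ⟨C₂, hC₂, hschur⟩ := exists_schurForm_irregularKernel_le h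
  refine ⟨C₁ * (1 + c * C₂), by positivity, fun w τ M hw hτ hM hΦ g hg => ?_⟩
  have hpt : ∀ t, (∫⁻ x, ‖schwartzFlow (w t) g x‖ₑ ^ (2 * p)) ^ (1 / 2 : ℝ) ≤
      ENNReal.ofReal C₁ * (1 + ENNReal.ofReal c * ∫⁻ ξ, ENNReal.ofReal (|ξ| ^ β) *
        ‖𝓕 (density (schwartzFlow (w t) g)) ξ‖ₑ ^ 2) := by
    intro t
    have h1 := hsob (density (schwartzFlow (w t) g)) (density _).continuous.measurable (by
      simp only [enorm_density_apply, lintegral_enorm_sq_schwartzFlow]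
      exact hg)
    have h2 : ∀ x, ‖density (schwartzFlow (w t) g) x‖ₑ ^ p =
        ‖schwartzFlow (w t) g x‖ₑ ^ (2 * p) := fun x => by
      rw [enorm_density_apply, ENNReal.rpow_mul, ENNReal.rpow_two]
    simp only [h2] at h1
    refine h1.trans ?_
    gcongr
    exact hgag _
  calc _ ≤ ∫⁻ t in Icc 0 τ, ENNReal.ofReal C₁ * (1 + ENNReal.ofReal c * ∫⁻ ξ,
        ENNReal.ofReal (|ξ| ^ β) * ‖𝓕 (density (schwartzFlow (w t) g)) ξ‖ₑ ^ 2) :=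
        lintegral_mono hpt
    _ = ENNReal.ofReal C₁ * (ENNReal.ofReal τ + ENNReal.ofReal c * ∫⁻ t in Icc 0 τ, ∫⁻ ξ,
        ENNReal.ofReal (|ξ| ^ β) * ‖𝓕 (density (schwartzFlow (w t) g)) ξ‖ₑ ^ 2) := by
        rw [lintegral_const_mul' _ _ ENNReal.ofReal_ne_top, lintegral_add_left measurable_const,
          lintegral_const_mul' _ _ ENNReal.ofReal_ne_top]
        simp
    _ ≤ ENNReal.ofReal C₁ * (ENNReal.ofReal τ + ENNReal.ofReal c *
        (ENNReal.ofReal M * ENNReal.ofReal C₂)) := by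
        gcongr
        refine (setLIntegral_fourier_density_le hw hτ hM hρ hΦ g).trans ?_
        gcongr
        exact hschur _ (by have := g.continuous.measurable; fun_prop) hg
    _ ≤ _ := by
        rw [← ENNReal.ofReal_mul hM, ← ENNReal.ofReal_mul hc.le,
          ← ENNReal.ofReal_add hτ (by positivity), ← ENNReal.ofReal_mul hC₁.le]
        apply ENNReal.ofReal_le_ofReal
        rw [mul_assoc]
        gcongr
        have : 0 ≤ c * C₂ * τ := by positivity
        nlinarith

open Filter Topology

/-! ### Strong continuity of the Schrödinger group -/

theorem coeFn_schrodingerSymbol (a : ℝ) (f : L2) :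
    schrodingerSymbol a f =ᵐ[volume]
      fun ξ : ℝ => Complex.exp (Complex.I * ((-a * (2 * Real.pi * ξ) ^ 2 : ℝ) : ℂ)) * f ξ :=
  coeFn_phaseMul (by fun_prop) f

theorem continuous_schrodingerSymbol (f : L2) : Continuous fun a => schrodingerSymbol a f := by
  rw [continuous_iff_continuousAt]
  intro a
  rw [ContinuousAt, Lp.tendsto_Lp_iff_tendsto_eLpNorm']
  set e : ℝ → ℝ → ℂ := fun b ξ =>
    Complex.exp (Complex.I * ((-b * (2 * Real.pi * ξ) ^ 2 : ℝ) : ℂ)) with he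
  have hnorm : ∀ b, eLpNorm (⇑(schrodingerSymbol b f) - ⇑(schrodingerSymbol a f)) 2 volume =
      (∫⁻ ξ, ‖(e b ξ - e a ξ) * f ξ‖ₑ ^ (2 : ℝ)) ^ (1 / 2 : ℝ) := by
    intro b
    rw [eLpNorm_eq_lintegral_rpow_enorm_toReal (by norm_num) (by norm_num), ENNReal.toReal_ofNat]
    congr 1
    refine lintegral_congr_ae ?_
    filter_upwards [coeFn_schrodingerSymbol a f, coeFn_schrodingerSymbol b f] with ξ h1 h2
    rw [Pi.sub_apply, h1, h2, ← sub_mul]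
  simp only [hnorm]
  have hfm : AEStronglyMeasurable f volume := Lp.aestronglyMeasurable f
  have hbound : ∫⁻ ξ, (2 * ‖hfm.mk f ξ‖ₑ) ^ (2 : ℝ) ≠ ∞ := by
    have h1 : eLpNorm f 2 volume < ∞ := (Lp.memLp f).2
    have h2 := lintegral_rpow_enorm_lt_top_of_eLpNorm_lt_top (by norm_num) (by norm_num) h1
    rw [ENNReal.toReal_ofNat] at h2
    have h3 : ∫⁻ ξ, ‖hfm.mk f ξ‖ₑ ^ (2 : ℝ) < ∞ := by
      refine lt_of_eq_of_lt (lintegral_congr_ae ?_) h2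
      filter_upwards [hfm.ae_eq_mk] with ξ h
      rw [← h]
    simp only [ENNReal.mul_rpow_of_nonneg _ _ (zero_le_two (α := ℝ))]
    rw [lintegral_const_mul' _ _ (by simp)]
    exact ENNReal.mul_ne_top (by simp) h3.ne
  have hlim : Tendsto (fun b => ∫⁻ ξ, ‖(e b ξ - e a ξ) * hfm.mk f ξ‖ₑ ^ (2 : ℝ)) (𝓝 a)
      (𝓝 (∫⁻ _ : ℝ, 0)) := by
    have hm : Measurable (hfm.mk f) := hfm.stronglyMeasurable_mk.measurable
    refine tendsto_lintegral_filter_of_dominated_convergence _ (Eventually.of_forall fun b => ?_)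
      (Eventually.of_forall fun b => Eventually.of_forall fun ξ => ?_) hbound
      (Eventually.of_forall fun ξ => ?_)
    · fun_prop
    · rw [enorm_mul]
      gcongr
      rw [← ofReal_norm, ← ENNReal.ofReal_ofNat]
      refine ENNReal.ofReal_le_ofReal ((norm_sub_le _ _).trans ?_)
      rw [he]
      simp only [norm_exp_phase]
      norm_num
    · have hc : Continuous fun b => ‖(e b ξ - e a ξ) * hfm.mk f ξ‖ₑ ^ (2 : ℝ) :=
        ENNReal.continuous_rpow_const.comp (continuous_enorm.comp (by fun_prop))
      have := hc.tendsto a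
      simpa using this
  have hcong : ∀ b, ∫⁻ ξ, ‖(e b ξ - e a ξ) * f ξ‖ₑ ^ (2 : ℝ) =
      ∫⁻ ξ, ‖(e b ξ - e a ξ) * hfm.mk f ξ‖ₑ ^ (2 : ℝ) := by
    intro b
    refine lintegral_congr_ae ?_
    filter_upwards [hfm.ae_eq_mk] with ξ h
    rw [← h]
  simp only [hcong]
  have := (ENNReal.continuous_rpow_const (y := 1 / 2)).continuousAt.tendsto.comp hlim
  simpa [Function.comp_def] using this

/-- Joint continuity follows from strong continuity because the operators are isometries. -/
theorem continuous_schrodingerGroup :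
    Continuous fun z : ℝ × L2 => schrodingerGroup z.1 z.2 := by
  have h1 : Continuous fun z : ℝ × L2 => schrodingerSymbol z.1 z.2 := by
    refine continuous_iff_continuousAt.2 fun z₀ => ?_
    rw [ContinuousAt, tendsto_iff_dist_tendsto_zero]
    have hz : Tendsto (fun z : ℝ × L2 => dist z.2 z₀.2 +
        dist (schrodingerSymbol z.1 z₀.2) (schrodingerSymbol z₀.1 z₀.2)) (𝓝 z₀) (𝓝 (0 + 0)) := by
      refine Tendsto.add ?_ ?_
      · have : Continuous fun z : ℝ × L2 => dist z.2 z₀.2 := by fun_prop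
        simpa using this.tendsto z₀
      · have : Continuous fun z : ℝ × L2 =>
            dist (schrodingerSymbol z.1 z₀.2) (schrodingerSymbol z₀.1 z₀.2) :=
          (((continuous_schrodingerSymbol z₀.2).comp continuous_fst).dist continuous_const)
        simpa using this.tendsto z₀
    rw [add_zero] at hz
    refine squeeze_zero (fun _ => dist_nonneg) (fun z => ?_) hz
    refine (dist_triangle _ (schrodingerSymbol z.1 z₀.2) _).trans ?_
    rw [LinearIsometryEquiv.dist_map]
  exact (Lp.fourierTransformₗᵢ ℝ ℂ).symm.continuous.comp
    (h1.comp (continuous_fst.prodMk ((Lp.fourierTransformₗᵢ ℝ ℂ).continuous.comp continuous_snd)))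

theorem continuous_schrodingerGroup_apply {X : Type*} [TopologicalSpace X] {a : X → ℝ} {f : X → L2}
    (ha : Continuous a) (hf : Continuous f) : Continuous fun x => schrodingerGroup (a x) (f x) := by
  have h := continuous_schrodingerGroup.comp (ha.prodMk hf)
  exact h

theorem schrodingerGroup_symm_apply (a : ℝ) (f : L2) :
    (schrodingerGroup a).symm f = schrodingerGroup (-a) f := by
  rw [LinearIsometryEquiv.symm_apply_eq]
  have h : ∀ g : L2, schrodingerSymbol a (schrodingerSymbol (-a) g) = g := fun g =>
    phaseMul_neg_phaseMul (by fun_prop) (by fun_prop) (fun ξ => by ring) g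
  simp only [schrodingerGroup, LinearIsometryEquiv.trans_apply,
    LinearIsometryEquiv.apply_symm_apply, h, LinearIsometryEquiv.symm_apply_apply]

/-- On data whose Fourier transform is a Schwartz function the group is `schwartzFlow`. -/
theorem schrodingerGroup_fourierInv_toLp (a : ℝ) (g : 𝓢(ℝ, ℂ)) :
    schrodingerGroup a ((Lp.fourierTransformₗᵢ ℝ ℂ).symm (g.toLp 2)) =
      (schwartzFlow a g).toLp 2 := by
  have h1 : schrodingerSymbol a (g.toLp 2) =
      (phaseSchwartz (fun ξ => -a * (2 * Real.pi * ξ) ^ 2) g).toLp 2 := by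
    apply Lp.ext
    filter_upwards [coeFn_schrodingerSymbol a (g.toLp 2), g.coeFn_toLp 2,
      (phaseSchwartz (fun ξ => -a * (2 * Real.pi * ξ) ^ 2) g).coeFn_toLp 2] with ξ h1 h2 h3
    rw [h1, h2, h3, phaseSchwartz_apply (hasTemperateGrowth_schrodingerPhase a)]
  simp only [schrodingerGroup, LinearIsometryEquiv.trans_apply,
    LinearIsometryEquiv.apply_symm_apply, h1]
  exact SchwartzMap.toLp_fourierInv_eq _

/-! ### The `L^q` norm as a function on `L²` -/

/-- By Fatou's lemma, `L^q` balls are closed in `L²`. -/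
theorem lowerSemicontinuous_eLpNorm_sub (q : ℝ≥0∞) {h : ℝ → ℂ}
    (hh : AEStronglyMeasurable h volume) :
    LowerSemicontinuous fun φ : L2 => eLpNorm (⇑φ - h) q volume := by
  rw [lowerSemicontinuous_iff_isClosed_preimage]
  intro r
  refine IsSeqClosed.isClosed fun φ φ₀ hφ hlim => ?_
  obtain ⟨ns, -, hae⟩ := (tendstoInMeasure_of_tendsto_Lp hlim).exists_seq_tendsto_ae
  have := Lp.eLpNorm_lim_le_liminf_eLpNorm (p := q) (f := fun n => ⇑(φ (ns n)) - h)
    (fun n => (Lp.aestronglyMeasurable _).sub hh) (⇑φ₀ - h) (by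
      filter_upwards [hae] with x hx
      exact hx.sub tendsto_const_nhds)
  refine this.trans (liminf_le_of_frequently_le' (Frequently.of_forall fun n => hφ (ns n)))

theorem lowerSemicontinuous_eLpNorm (q : ℝ≥0∞) :
    LowerSemicontinuous fun φ : L2 => eLpNorm φ q volume := by
  simpa using lowerSemicontinuous_eLpNorm_sub q (h := 0) aestronglyMeasurable_zero

/-- A Fatou lemma for lower semicontinuous functionals. -/
theorem lintegral_le_liminf_of_lowerSemicontinuous {X : Type*} [TopologicalSpace X]
    {Ψ : X → ℝ≥0∞} (hΨ : LowerSemicontinuous Ψ) {μ : Measure ℝ} {a : ℕ → ℝ → X} {a₀ : ℝ → X}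
    (ha : ∀ n, Continuous (a n)) (hlim : ∀ᵐ t ∂μ, Tendsto (fun n => a n t) atTop (𝓝 (a₀ t)))
    {p : ℝ} (hp : 0 < p) :
    ∫⁻ t, Ψ (a₀ t) ^ p ∂μ ≤ liminf (fun n => ∫⁻ t, Ψ (a n t) ^ p ∂μ) atTop := by
  have hΨp : LowerSemicontinuous fun x => Ψ x ^ p :=
    (ENNReal.continuous_rpow_const (y := p)).comp_lowerSemicontinuous hΨ
      (ENNReal.monotone_rpow_of_nonneg hp.le)
  refine le_trans (lintegral_mono_ae ?_) (lintegral_liminf_le fun n =>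
    (LowerSemicontinuous.comp hΨp (ha n)).measurable)
  filter_upwards [hlim] with t ht
  exact (LowerSemicontinuousAt.le_liminf (hΨp (a₀ t))).trans (liminf_le_liminf_of_le ht)

/-- A continuous family in `L²` is strongly measurable as a family in `L^q`, at the times at which
it belongs to `L^q`, because the distance in `L^q` is lower semicontinuous on `L²`. -/
theorem exists_stronglyMeasurable_eLpNorm_eq {q : ℝ≥0∞} [Fact (1 ≤ q)] (hq : q ≠ ∞)
    {u : ℝ → L2} (hu : Continuous u) :
    ∃ v : ℝ → Lp ℂ q (volume : Measure ℝ), StronglyMeasurable v ∧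
      ∀ t, eLpNorm (u t) q volume < ∞ →
        (v t : ℝ → ℂ) =ᵐ[volume] u t ∧ ‖v t‖ₑ = eLpNorm (u t) q volume := by
  classical
  have : Fact (q ≠ ∞) := ⟨hq⟩
  have hmem : ∀ t, eLpNorm (u t) q volume < ∞ → MemLp (u t) q volume := fun t h =>
    ⟨Lp.aestronglyMeasurable _, h⟩
  refine ⟨fun t => if h : eLpNorm (u t) q volume < ∞ then (hmem t h).toLp _ else 0, ?_, ?_⟩
  · let _ : MeasurableSpace (Lp ℂ q (volume : Measure ℝ)) := borel _
    have hborel : BorelSpace (Lp ℂ q (volume : Measure ℝ)) := ⟨rfl⟩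
    refine Measurable.stronglyMeasurable ?_
    have hbasis : TopologicalSpace.IsTopologicalBasis
        {s : Set (Lp ℂ q (volume : Measure ℝ)) | ∃ x r, s = Metric.eball x r} := by
      refine TopologicalSpace.isTopologicalBasis_of_isOpen_of_nhds ?_ ?_
      · rintro _ ⟨x, r, rfl⟩
        exact Metric.isOpen_eball
      · intro x s hx hs
        obtain ⟨r, hr, hrs⟩ := EMetric.isOpen_iff.1 hs x hx
        exact ⟨_, ⟨x, r, rfl⟩, Metric.mem_eball_self hr, hrs⟩
    rw [hborel.measurable_eq,
      hbasis.borel_eq_generateFrom]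
    refine measurable_generateFrom ?_
    rintro _ ⟨x, r, rfl⟩
    have hN : Measurable fun t => eLpNorm (u t) q volume :=
      (LowerSemicontinuous.comp (lowerSemicontinuous_eLpNorm q) hu).measurable
    have hNx : Measurable fun t => eLpNorm (⇑(u t) - ⇑x) q volume :=
      (LowerSemicontinuous.comp
        (lowerSemicontinuous_eLpNorm_sub q (Lp.aestronglyMeasurable x)) hu).measurable
    have hset : (fun t => if h : eLpNorm (u t) q volume < ∞ then (hmem t h).toLp _ else 0) ⁻¹'
        Metric.eball x r =
        ({t | eLpNorm (u t) q volume < ∞} ∩ {t | eLpNorm (⇑(u t) - ⇑x) q volume < r}) ∪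
          ({t | ¬ eLpNorm (u t) q volume < ∞} ∩ {_t | edist 0 x < r}) := by
      ext t
      by_cases h : eLpNorm (u t) q volume < ∞
      · have : edist ((hmem t h).toLp _) x = eLpNorm (⇑(u t) - ⇑x) q volume := by
          rw [Lp.edist_def]
          refine eLpNorm_congr_ae ?_
          filter_upwards [(hmem t h).coeFn_toLp] with y hy
          rw [Pi.sub_apply, Pi.sub_apply, hy]
        simp only [mem_preimage, mem_union, mem_inter_iff, mem_ofPred_eq, h, dif_pos,
          Metric.mem_eball, this, true_and, not_true_eq_false, false_and, or_false]
      · simp only [mem_preimage, mem_union, mem_inter_iff, mem_ofPred_eq, h, dite_false,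
          Metric.mem_eball, false_and, not_false_eq_true, true_and, false_or]
    rw [hset]
    refine ((measurableSet_lt hN measurable_const).inter
      (measurableSet_lt hNx measurable_const)).union
      ((measurableSet_lt hN measurable_const).compl.inter ?_)
    exact MeasurableSet.const _
  · intro t h
    simp only [h, dif_pos]
    refine ⟨(hmem t h).coeFn_toLp, ?_⟩
    rw [Lp.enorm_toLp]

/-! ### The homogeneous Strichartz estimate -/

/-- The element of `L²` whose Fourier transform is the Schwartz function `g`. -/
noncomputable def fourierDatum (g : 𝓢(ℝ, ℂ)) : L2 :=
  (Lp.fourierTransformₗᵢ ℝ ℂ).symm (g.toLp 2)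

theorem fourierDatum_smul (c : ℂ) (g : 𝓢(ℝ, ℂ)) : fourierDatum (c • g) = c • fourierDatum g := by
  have h : (c • g).toLp 2 = c • (g.toLp 2 : L2) :=
    map_smul (toLpCLM ℂ ℂ 2 (volume : Measure ℝ)) c g
  rw [fourierDatum, h, map_smul, fourierDatum]

theorem norm_fourierDatum (g : 𝓢(ℝ, ℂ)) : ‖fourierDatum g‖ = ‖(g.toLp 2 : L2)‖ :=
  LinearIsometryEquiv.norm_map _ _

theorem denseRange_fourierDatum : DenseRange fourierDatum :=
  (Lp.fourierTransformₗᵢ ℝ ℂ).symm.surjective.denseRange.comp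
    (denseRange_toLpCLM (E := ℝ) (F := ℂ) (p := 2) (μ := volume) ENNReal.ofNat_ne_top)
    (Lp.fourierTransformₗᵢ ℝ ℂ).symm.continuous

/-- The `p`-th power of the `L^p([0, τ], L^q)` norm of `t ↦ e^{i w_t ∂²} φ`. -/
noncomputable def strichartzIntegral (p : ℝ) (q : ℝ≥0∞) (w : ℝ → ℝ) (τ : ℝ) (φ : L2) : ℝ≥0∞ :=
  ∫⁻ t in Icc 0 τ, eLpNorm (schrodingerGroup (w t) φ) q volume ^ p

theorem strichartzIntegral_smul {p : ℝ} (hp : 0 < p) (q : ℝ≥0∞) (w : ℝ → ℝ) (τ : ℝ) (c : ℂ)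
    (φ : L2) :
    strichartzIntegral p q w τ (c • φ) = ‖c‖ₑ ^ p * strichartzIntegral p q w τ φ := by
  rw [strichartzIntegral, strichartzIntegral,
    ← lintegral_const_mul' _ _ (ENNReal.rpow_ne_top_of_nonneg hp.le enorm_ne_top)]
  refine lintegral_congr fun t => ?_
  rw [map_smul, eLpNorm_congr_ae (Lp.coeFn_smul _ _), eLpNorm_const_smul,
    ENNReal.mul_rpow_of_nonneg _ _ hp.le]

theorem strichartzIntegral_fourierDatum {p : ℝ} (hp : 0 < p) (w : ℝ → ℝ) (τ : ℝ) (g : 𝓢(ℝ, ℂ)) :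
    strichartzIntegral p (ENNReal.ofReal (2 * p)) w τ (fourierDatum g) =
      ∫⁻ t in Icc 0 τ, (∫⁻ x, ‖schwartzFlow (w t) g x‖ₑ ^ (2 * p)) ^ (1 / 2 : ℝ) := by
  refine lintegral_congr fun t => ?_
  rw [fourierDatum, schrodingerGroup_fourierInv_toLp,
    eLpNorm_congr_ae ((schwartzFlow (w t) g).coeFn_toLp 2 volume),
    eLpNorm_eq_lintegral_rpow_enorm_toReal (by simpa using hp) ENNReal.ofReal_ne_top,
    ENNReal.toReal_ofReal (by linarith), ← ENNReal.rpow_mul]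
  congr 1
  field_simp

theorem lintegral_enorm_sq_le_one_of_norm_le_one {g : 𝓢(ℝ, ℂ)} (hg : ‖fourierDatum g‖ ≤ 1) :
    ∫⁻ ξ, ‖g ξ‖ₑ ^ 2 ≤ 1 := by
  have h1 : ‖(g.toLp 2 : L2)‖ₑ ≤ 1 := by
    rw [← ofReal_norm, ENNReal.ofReal_le_one]
    rwa [norm_fourierDatum] at hg
  rw [SchwartzMap.toLp, Lp.enorm_toLp,
    eLpNorm_eq_lintegral_rpow_enorm_toReal (by norm_num) (by norm_num),
    ENNReal.toReal_ofNat] at h1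
  have h2 := ENNReal.rpow_le_rpow h1 (zero_le_two (α := ℝ))
  rw [← ENNReal.rpow_mul] at h2
  simpa using h2

/-- A bound on normalised data extends to all data whose Fourier transform is a Schwartz function
by scaling, and to all of `L²` by density and Fatou's lemma. -/
theorem strichartzIntegral_le_of_normalised {p : ℝ} (hp : 0 < p) {q : ℝ≥0∞} {w : ℝ → ℝ}
    (hw : Continuous w) {τ : ℝ} {K : ℝ≥0∞} (hK : K ≠ ∞)
    (h : ∀ g : 𝓢(ℝ, ℂ), ‖fourierDatum g‖ ≤ 1 → strichartzIntegral p q w τ (fourierDatum g) ≤ K)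
    (φ : L2) : strichartzIntegral p q w τ φ ≤ K * ‖φ‖ₑ ^ p := by
  have hschwartz : ∀ g : 𝓢(ℝ, ℂ),
      strichartzIntegral p q w τ (fourierDatum g) ≤ K * ‖fourierDatum g‖ₑ ^ p := by
    intro g
    rcases eq_or_ne (fourierDatum g) 0 with h0 | h0
    · have := strichartzIntegral_smul hp q w τ 0 (fourierDatum g)
      rw [zero_smul, enorm_zero, ENNReal.zero_rpow_of_pos hp, zero_mul] at this
      rw [h0, this]
      exact zero_le
    have hn : ‖fourierDatum g‖ ≠ 0 := norm_ne_zero_iff.2 h0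
    set c : ℂ := ((‖fourierDatum g‖ : ℝ) : ℂ) with hc
    have hc0 : c ≠ 0 := Complex.ofReal_ne_zero.2 hn
    have hcn : ‖c‖ = ‖fourierDatum g‖ := by rw [hc, Complex.norm_real, norm_norm]
    have hce : ‖c‖ₑ = ‖fourierDatum g‖ₑ := by rw [← ofReal_norm, hcn, ofReal_norm]
    have h1 := h (c⁻¹ • g) (by
      rw [fourierDatum_smul, norm_smul, norm_inv, hcn, inv_mul_cancel₀ hn])
    have h2 : fourierDatum g = c • fourierDatum (c⁻¹ • g) := by
      rw [fourierDatum_smul, smul_smul, mul_inv_cancel₀ hc0, one_smul]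
    calc strichartzIntegral p q w τ (fourierDatum g)
        = ‖c‖ₑ ^ p * strichartzIntegral p q w τ (fourierDatum (c⁻¹ • g)) := by
          rw [← strichartzIntegral_smul hp, ← h2]
      _ ≤ ‖c‖ₑ ^ p * K := by gcongr
      _ = K * ‖fourierDatum g‖ₑ ^ p := by rw [hce, mul_comm]
  obtain ⟨x, hx, hlim⟩ := mem_closure_iff_seq_limit.1 (denseRange_fourierDatum φ)
  choose g hg using hx
  have hnormlim : Tendsto (fun n => K * ‖x n‖ₑ ^ p) atTop (𝓝 (K * ‖φ‖ₑ ^ p)) := by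
    refine ENNReal.Tendsto.const_mul ?_ (Or.inr hK)
    exact (((ENNReal.continuous_rpow_const (y := p)).comp continuous_enorm).tendsto φ).comp hlim
  calc strichartzIntegral p q w τ φ ≤ liminf (fun n => strichartzIntegral p q w τ (x n)) atTop :=
        lintegral_le_liminf_of_lowerSemicontinuous (lowerSemicontinuous_eLpNorm q)
          (fun n => continuous_schrodingerGroup_apply hw continuous_const)
          (Eventually.of_forall fun t =>
            ((schrodingerGroup (w t)).continuous.tendsto φ).comp hlim) hp
    _ ≤ liminf (fun n => K * ‖x n‖ₑ ^ p) atTop := by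
        refine liminf_le_liminf (Eventually.of_forall fun n => ?_)
        rw [← hg n]
        exact hschwartz (g n)
    _ = _ := hnormlim.liminf_eq

/-- The homogeneous Strichartz estimate. -/
theorem exists_strichartzIntegral_le {p ρ β : ℝ} (hp : 1 ≤ p) (hρ : 0 < ρ)
    (hβ : 0 < β) (hβ1 : β ≤ 1) (hpβ : p ≤ 2 + (2 + β) * β)
    (h : (1 < ρ ∧ β = 1) ∨ (0 < β ∧ β < 1 ∧ β < 2 * ρ - 1 ∧ β ≤ ρ)) :
    ∃ C : ℝ, 0 < C ∧ ∀ (w : ℝ → ℝ) (τ M : ℝ), Continuous w → 0 ≤ τ → 0 ≤ M →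
      (∀ a, ‖occupationFourier w 0 τ a‖ ≤ M * (1 + |a|) ^ (-ρ)) →
      ∀ φ : L2, strichartzIntegral p (ENNReal.ofReal (2 * p)) w τ φ ≤
        ENNReal.ofReal (C * (τ + M)) * ‖φ‖ₑ ^ p := by
  obtain ⟨C, hC, hflow⟩ := exists_setLIntegral_schwartzFlow_le hp hρ hβ hβ1 hpβ h
  have hp0 : 0 < p := by linarith
  refine ⟨C, hC, fun w τ M hw hτ hM hΦ => strichartzIntegral_le_of_normalised hp0 hw
    ENNReal.ofReal_ne_top fun g hg => ?_⟩
  rw [strichartzIntegral_fourierDatum hp0]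
  exact hflow w τ M hw hτ hM hΦ g (lintegral_enorm_sq_le_one_of_norm_le_one hg)

/-! ### The inhomogeneous estimate -/

/-- The family `t ↦ e^{i w_t ∂²} ∫_0^t χ_s dμ(s)`. -/
noncomputable def primitiveFlow (w : ℝ → ℝ) (μ : Measure ℝ) (χ : ℝ → L2) (t : ℝ) : L2 :=
  schrodingerGroup (w t) (∫ s in (0 : ℝ)..t, χ s ∂μ)

theorem continuous_primitiveFlow {w : ℝ → ℝ} (hw : Continuous w) {μ : Measure ℝ}
    [NullSingletonClass μ] {χ : ℝ → L2} (hχ : Integrable χ μ) : Continuous (primitiveFlow w μ χ) := by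
  have h1 : Continuous fun t => ∫ s in (0 : ℝ)..t, χ s ∂μ :=
    intervalIntegral.continuous_primitive (fun _ _ => hχ.intervalIntegrable) 0
  exact continuous_schrodingerGroup_apply hw h1

theorem measurable_eLpNorm_primitiveFlow {w : ℝ → ℝ} (hw : Continuous w) {μ : Measure ℝ}
    [NullSingletonClass μ] {χ : ℝ → L2} (hχ : Integrable χ μ) (q : ℝ≥0∞) :
    Measurable fun t => eLpNorm (primitiveFlow w μ χ t) q volume :=
  (LowerSemicontinuous.comp (lowerSemicontinuous_eLpNorm q)
    (continuous_primitiveFlow hw hχ)).measurable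

theorem primitiveFlow_add (w : ℝ → ℝ) {μ : Measure ℝ} {f g : ℝ → L2} (hf : Integrable f μ)
    (hg : Integrable g μ) (t : ℝ) :
    primitiveFlow w μ (f + g) t = primitiveFlow w μ f t + primitiveFlow w μ g t := by
  have h1 : ∫ s in (0 : ℝ)..t, (f + g) s ∂μ =
      (∫ s in (0 : ℝ)..t, f s ∂μ) + ∫ s in (0 : ℝ)..t, g s ∂μ :=
    intervalIntegral.integral_add hf.intervalIntegrable hg.intervalIntegrable
  rw [primitiveFlow, h1, map_add, primitiveFlow, primitiveFlow]

theorem primitiveFlow_congr_ae (w : ℝ → ℝ) {μ : Measure ℝ} {f g : ℝ → L2} (h : f =ᵐ[μ] g) :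
    primitiveFlow w μ f = primitiveFlow w μ g := by
  funext t
  have h1 : ∫ s in (0 : ℝ)..t, f s ∂μ = ∫ s in (0 : ℝ)..t, g s ∂μ :=
    intervalIntegral.integral_congr_ae_restrict (ae_restrict_of_ae h)
  rw [primitiveFlow, h1, primitiveFlow]

theorem tendsto_primitiveFlow (w : ℝ → ℝ) {μ : Measure ℝ} {f : ℕ → Lp L2 1 μ} {f₀ : Lp L2 1 μ}
    (hlim : Tendsto f atTop (𝓝 f₀)) (t : ℝ) :
    Tendsto (fun n => primitiveFlow w μ (f n) t) atTop (𝓝 (primitiveFlow w μ f₀ t)) := by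
  refine ((schrodingerGroup (w t)).continuous.tendsto _).comp ?_
  have hset : ∀ A : Set ℝ, Tendsto (fun n => ∫ s in A, f n s ∂μ) atTop
      (𝓝 (∫ s in A, f₀ s ∂μ)) := fun A =>
    ((continuous_setIntegral A).tendsto f₀).comp hlim
  exact (hset _).sub (hset _)

/-- For `χ = 1_s c` the Duhamel term is at most `μ s` times the homogeneous solution with
datum `c`. -/
theorem eLpNorm_primitiveFlow_indicator_le (w : ℝ → ℝ) {μ : Measure ℝ} (q : ℝ≥0∞) (c : L2)
    {s : Set ℝ} (hs : MeasurableSet s) {t : ℝ} (ht : 0 ≤ t) :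
    eLpNorm (primitiveFlow w μ (s.indicator fun _ => c) t) q volume ≤
      μ s * eLpNorm (schrodingerGroup (w t) c) q volume := by
  have h1 : primitiveFlow w μ (s.indicator fun _ => c) t =
      (((μ.restrict (Ioc 0 t)).real s : ℝ) : ℂ) • schrodingerGroup (w t) c := by
    rw [primitiveFlow, intervalIntegral.integral_of_le ht, integral_indicator hs,
      setIntegral_const, ← map_smul]
    congr 1
  rw [h1, eLpNorm_congr_ae (Lp.coeFn_smul _ _), eLpNorm_const_smul]
  gcongr
  rw [← ofReal_norm, Complex.norm_real, Measure.real, Real.norm_of_nonneg ENNReal.toReal_nonneg]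
  exact ENNReal.ofReal_toReal_le.trans (Measure.restrict_apply_le _ _)

theorem lintegral_enorm_add_of_disjoint_support {μ : Measure ℝ} {f g : ℝ → L2}
    (hdisj : Disjoint (Function.support f) (Function.support g)) (hf : Integrable f μ) :
    ∫⁻ s, ‖(f + g) s‖ₑ ∂μ = (∫⁻ s, ‖f s‖ₑ ∂μ) + ∫⁻ s, ‖g s‖ₑ ∂μ := by
  rw [← lintegral_add_left' hf.aestronglyMeasurable.enorm]
  refine lintegral_congr fun s => ?_
  by_cases hfs : f s = 0
  · simp [hfs]
  · have hgs : g s = 0 := by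
      by_contra hgs
      exact Set.disjoint_left.1 hdisj hfs hgs
    simp [hgs]

/-- Minkowski's inequality for the Duhamel term, by induction on the integrable function `χ`; the
passage to limits in `L¹` is Fatou's lemma. -/
theorem lintegral_primitiveFlow_le {p : ℝ} (hp : 1 ≤ p) {q : ℝ≥0∞} (hq : 1 ≤ q) {w : ℝ → ℝ}
    (hw : Continuous w) {τ : ℝ} {K : ℝ≥0∞} (hK : K ≠ ∞)
    (hom : ∀ φ : L2, strichartzIntegral p q w τ φ ≤ K ^ p * ‖φ‖ₑ ^ p)
    {χ : ℝ → L2} (hχ : Integrable χ (volume.restrict (Icc 0 τ))) :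
    (∫⁻ t in Icc 0 τ, eLpNorm (primitiveFlow w (volume.restrict (Icc 0 τ)) χ t) q volume ^ p) ^
      (1 / p) ≤ K * ∫⁻ s in Icc 0 τ, ‖χ s‖ₑ := by
  have hp0 : 0 < p := by linarith
  refine Integrable.induction (μ := volume.restrict (Icc 0 τ)) (fun χ : ℝ → L2 =>
    (∫⁻ t in Icc 0 τ, eLpNorm (primitiveFlow w (volume.restrict (Icc 0 τ)) χ t) q volume ^ p) ^
      (1 / p) ≤ K * ∫⁻ s in Icc 0 τ, ‖χ s‖ₑ) ?_ ?_ ?_ ?_ hχ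
  · intro c s hs hμs
    calc _ ≤ (∫⁻ t in Icc 0 τ, (volume.restrict (Icc 0 τ)) s ^ p *
            eLpNorm (schrodingerGroup (w t) c) q volume ^ p) ^ (1 / p) := by
          gcongr 1
          refine setLIntegral_mono' measurableSet_Icc fun t ht => ?_
          rw [← ENNReal.mul_rpow_of_nonneg _ _ hp0.le]
          gcongr
          exact eLpNorm_primitiveFlow_indicator_le w q c hs ht.1
      _ ≤ ((volume.restrict (Icc 0 τ)) s ^ p * (K ^ p * ‖c‖ₑ ^ p)) ^ (1 / p) := by
          rw [lintegral_const_mul' _ _ (ENNReal.rpow_ne_top_of_nonneg hp0.le hμs.ne)]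
          gcongr
          exact hom c
      _ = (volume.restrict (Icc 0 τ)) s * (K * ‖c‖ₑ) := by
          rw [← ENNReal.mul_rpow_of_nonneg _ _ hp0.le, ← ENNReal.mul_rpow_of_nonneg _ _ hp0.le,
            one_div, ENNReal.rpow_rpow_inv hp0.ne']
      _ = _ := by
          simp only [enorm_indicator_eq_indicator_enorm]
          rw [lintegral_indicator hs, setLIntegral_const]
          ring
  · intro f g hdisj hf hg hPf hPg
    calc _ ≤ (∫⁻ t in Icc 0 τ, ((fun t => eLpNorm (primitiveFlow w (volume.restrict (Icc 0 τ)) f t)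
            q volume) + fun t => eLpNorm (primitiveFlow w (volume.restrict (Icc 0 τ)) g t)
            q volume) t ^ p) ^ (1 / p) := by
          gcongr with t
          rw [primitiveFlow_add w hf hg, eLpNorm_congr_ae (Lp.coeFn_add _ _)]
          exact eLpNorm_add_le (Lp.aestronglyMeasurable _) (Lp.aestronglyMeasurable _) hq
      _ ≤ _ := ENNReal.lintegral_Lp_add_le
          (measurable_eLpNorm_primitiveFlow hw hf q).aemeasurable
          (measurable_eLpNorm_primitiveFlow hw hg q).aemeasurable hp
      _ ≤ _ := add_le_add hPf hPg
      _ = _ := by rw [lintegral_enorm_add_of_disjoint_support hdisj hf, mul_add]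
  · refine IsSeqClosed.isClosed fun f f₀ hf hlim => ?_
    have hnorm : ∀ f : Lp L2 1 (volume.restrict (Icc 0 τ)), ∫⁻ s in Icc 0 τ, ‖f s‖ₑ = ‖f‖ₑ :=
      fun f => by rw [Lp.enorm_def, eLpNorm_one_eq_lintegral_enorm]
    have hnormlim : Tendsto (fun n => (K * ‖f n‖ₑ) ^ p) atTop (𝓝 ((K * ‖f₀‖ₑ) ^ p)) := by
      refine ((ENNReal.continuous_rpow_const (y := p)).tendsto _).comp ?_
      exact ENNReal.Tendsto.const_mul ((continuous_enorm.tendsto f₀).comp hlim) (Or.inr hK)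
    simp only [mem_ofPred_eq, hnorm, one_div, ENNReal.rpow_inv_le_iff hp0] at hf ⊢
    calc _ ≤ liminf (fun n => ∫⁻ t in Icc 0 τ,
          eLpNorm (primitiveFlow w (volume.restrict (Icc 0 τ)) (f n) t) q volume ^ p) atTop :=
          lintegral_le_liminf_of_lowerSemicontinuous (lowerSemicontinuous_eLpNorm q)
            (fun n => continuous_primitiveFlow hw (L1.integrable_coeFn (f n)))
            (Eventually.of_forall (tendsto_primitiveFlow w hlim)) hp0
      _ ≤ liminf (fun n => (K * ‖f n‖ₑ) ^ p) atTop :=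
          liminf_le_liminf (Eventually.of_forall hf)
      _ = _ := hnormlim.liminf_eq
  · intro f g hfg hf hPf
    have h2 : ∫⁻ s in Icc 0 τ, ‖g s‖ₑ = ∫⁻ s in Icc 0 τ, ‖f s‖ₑ := by
      refine lintegral_congr_ae ?_
      filter_upwards [hfg] with s hs
      rw [hs]
    rw [h2, ← primitiveFlow_congr_ae w hfg]
    exact hPf

/-! ### Assembling the estimate -/

/-- The choice of the number `β` of half-derivatives gained on the density: `β` must be admissible
for the Schur test at decay rate `ρ`, and large enough for the Sobolev inequality to reach `L^p`. -/
theorem exists_smoothing_exponent {p ρ : ℝ} (hp : p ∈ Ioc (2 : ℝ) 5)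
    (hρ : min (3 / 2 - 2 / p) 1 < ρ) :
    ∃ β : ℝ, 0 < β ∧ β ≤ 1 ∧ p ≤ 2 + (2 + β) * β ∧
      ((1 < ρ ∧ β = 1) ∨ (0 < β ∧ β < 1 ∧ β < 2 * ρ - 1 ∧ β ≤ ρ)) := by
  obtain ⟨hp2, hp5⟩ := hp
  have hp0 : 0 < p := by linarith
  rcases lt_or_ge 1 ρ with h1 | h1
  · exact ⟨1, one_pos, le_rfl, by linarith, Or.inl ⟨h1, rfl⟩⟩
  · have h2 : 3 / 2 - 2 / p < ρ := by
      rcases min_lt_iff.1 hρ with h | h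
      · exact h
      · linarith
    set x : ℝ := 2 / p with hx
    have hxp : x * p = 2 := div_mul_cancel₀ _ hp0.ne'
    have hx0 : 0 < x := by positivity
    have hx1 : x < 1 := by rw [hx, div_lt_one hp0]; exact hp2
    have hx2 : 1 / 2 < x := by linarith
    have hp4 : p < 4 := by nlinarith
    -- at `β = 2 - 4 / p` the endpoint exponent `2 + (2 + β) β` is at least `p` for `2 ≤ p ≤ 4`
    have key : p ≤ 2 + (2 + (2 - 2 * x)) * (2 - 2 * x) := by
      have h3 : 0 ≤ p ^ 2 * (2 + (2 + (2 - 2 * x)) * (2 - 2 * x) - p) := by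
        have : p ^ 2 * (2 + (2 + (2 - 2 * x)) * (2 - 2 * x) - p) =
            (p - 2) * (8 * (p - 1) - p ^ 2) := by
          have e : p ^ 2 * (2 + (2 + (2 - 2 * x)) * (2 - 2 * x) - p) =
            10 * p ^ 2 - 12 * p * (x * p) + 4 * (x * p) ^ 2 - p ^ 3 := by ring
          rw [e, hxp]
          ring
        rw [this]
        exact mul_nonneg (by linarith) (by nlinarith)
      have := nonneg_of_mul_nonneg_right h3 (by positivity)
      linarith
    exact ⟨2 - 2 * x, by linarith, by linarith, key,
      Or.inr ⟨by linarith, by linarith, by linarith, by linarith⟩⟩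

theorem IsIrregularOn.norm_occupationFourier_le {ρ γ T : ℝ} {w : ℝ → ℝ}
    (h : IsIrregularOn ρ γ T w) {τ : ℝ} (hτ : 0 < τ) (hτT : τ ≤ T) (a : ℝ) :
    ‖occupationFourier w 0 τ a‖ ≤
      (irregularityNorm ρ γ T w).toReal * τ ^ γ * (1 + |a|) ^ (-ρ) := by
  have h1 : ENNReal.ofReal ((1 + |a|) ^ ρ * (‖occupationFourier w 0 τ a‖ / |0 - τ| ^ γ)) ≤
      irregularityNorm ρ γ T w :=
    le_iSup_of_le a (le_iSup_of_le 0 (le_iSup_of_le τ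
      (le_iSup_of_le ⟨le_rfl, hτ, hτT⟩ le_rfl)))
  have h2 := (ENNReal.ofReal_le_iff_le_toReal h.norm_lt_top.ne).1 h1
  rw [zero_sub, abs_neg, abs_of_pos hτ] at h2
  have h3 : 0 < (1 + |a|) ^ ρ := by positivity
  have h4 : 0 < τ ^ γ := by positivity
  rw [Real.rpow_neg (by positivity), ← div_eq_mul_inv, le_div_iff₀ h3]
  rw [← mul_div_assoc, div_le_iff₀ h4] at h2
  linarith

/-- The homogeneous estimate along an irregular path, with the power `τ^{1/2}` of the length of the
time interval extracted. -/
theorem IsIrregularOn.exists_strichartzIntegral_le {p ρ γ T : ℝ} {w : ℝ → ℝ}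
    (hp : p ∈ Ioc (2 : ℝ) 5) (hT : 0 < T) (hρ : min (3 / 2 - 2 / p) 1 < ρ) (hγ : 1 / 2 < γ)
    (h : IsIrregularOn ρ γ T w) (hw : Continuous w) :
    ∃ C : ℝ, 0 < C ∧ ∀ τ, 0 < τ → τ ≤ T → ∀ φ : L2,
      strichartzIntegral p (ENNReal.ofReal (2 * p)) w τ φ ≤
        ENNReal.ofReal (C * τ ^ (1 / (2 * p))) ^ p * ‖φ‖ₑ ^ p := by
  have hp0 : 0 < p := by linarith [hp.1]
  obtain ⟨β, hβ, hβ1, hpβ, hor⟩ := exists_smoothing_exponent hp hρ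
  obtain ⟨C₀, hC₀, hom⟩ :=
    ModulatedSchrodinger.exists_strichartzIntegral_le (by linarith [hp.1]) h.rho_pos hβ hβ1 hpβ hor
  set M₀ : ℝ := (irregularityNorm ρ γ T w).toReal with hM₀
  have hM₀0 : 0 ≤ M₀ := ENNReal.toReal_nonneg
  set C₁ : ℝ := C₀ * (T ^ (1 / 2 : ℝ) + M₀ * T ^ (γ - 1 / 2)) with hC₁
  have hC₁0 : 0 < C₁ := by positivity
  refine ⟨C₁ ^ (1 / p), by positivity, fun τ hτ hτT φ => ?_⟩
  refine (hom w τ (M₀ * τ ^ γ) hw hτ.le (by positivity)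
    (h.norm_occupationFourier_le hτ hτT) φ).trans ?_
  gcongr
  rw [ENNReal.ofReal_rpow_of_nonneg (by positivity) hp0.le]
  apply ENNReal.ofReal_le_ofReal
  have e1 : (C₁ ^ (1 / p) * τ ^ (1 / (2 * p))) ^ p = C₁ * τ ^ (1 / 2 : ℝ) := by
    rw [Real.mul_rpow (by positivity) (by positivity), ← Real.rpow_mul hC₁0.le,
      ← Real.rpow_mul hτ.le, one_div_mul_cancel hp0.ne', Real.rpow_one]
    congr 2
    field_simp
  have e2 : τ ≤ T ^ (1 / 2 : ℝ) * τ ^ (1 / 2 : ℝ) := by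
    calc τ = τ ^ (1 / 2 : ℝ) * τ ^ (1 / 2 : ℝ) := by
          rw [← Real.rpow_add hτ]
          norm_num
      _ ≤ _ := by gcongr
  have e3 : τ ^ γ ≤ T ^ (γ - 1 / 2) * τ ^ (1 / 2 : ℝ) := by
    calc τ ^ γ = τ ^ (γ - 1 / 2) * τ ^ (1 / 2 : ℝ) := by
          rw [← Real.rpow_add hτ]
          ring_nf
      _ ≤ _ := by
          gcongr
  rw [e1, hC₁, mul_assoc, add_mul, mul_assoc M₀]
  gcongr

/-- Irregularity depends only on the restriction of the path to `[0, T]`, so the path may be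
extended to a continuous function on the line. -/
theorem IsIrregularOn.congr {ρ γ T : ℝ} {w w' : ℝ → ℝ} (h : IsIrregularOn ρ γ T w)
    (hw' : Continuous w') (heq : ∀ t ∈ Icc 0 T, w' t = w t) : IsIrregularOn ρ γ T w' := by
  refine ⟨h.rho_pos, h.gamma_pos, hw'.continuousOn, lt_of_eq_of_lt ?_ h.norm_lt_top⟩
  refine iSup_congr fun a => iSup_congr fun s => iSup_congr fun t => iSup_congr fun hst => ?_
  have : occupationFourier w' s t a = occupationFourier w s t a := by
    refine intervalIntegral.integral_congr fun r hr => ?_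
    rw [uIcc_of_le hst.2.1.le] at hr
    rw [heq r ⟨hst.1.trans hr.1, hr.2.trans hst.2.2⟩]
  rw [this]

/-- The pulled-back source `(U^w_s)⁻¹ ψ_s`. -/
noncomputable def pullback (w : ℝ → ℝ) (ψ : ℝ → L2) (s : ℝ) : L2 :=
  schrodingerGroup (-w s) (ψ s)

theorem enorm_pullback (w : ℝ → ℝ) (ψ : ℝ → L2) (s : ℝ) : ‖pullback w ψ s‖ₑ = ‖ψ s‖ₑ := by
  rw [← ofReal_norm, ← ofReal_norm, pullback, LinearIsometryEquiv.norm_map]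

theorem integrable_pullback {w : ℝ → ℝ} (hw : Continuous w) {μ : Measure ℝ} {ψ : ℝ → L2}
    (hψ : Integrable ψ μ) : Integrable (pullback w ψ) μ := by
  have h1 : AEStronglyMeasurable (fun s => (-w s, ψ s)) μ :=
    hw.neg.aestronglyMeasurable.prodMk hψ.aestronglyMeasurable
  have h2 : AEStronglyMeasurable (pullback w ψ) μ := by
    have h := continuous_schrodingerGroup.comp_aestronglyMeasurable h1
    exact h
  refine hψ.congr' h2 (Filter.Eventually.of_forall fun s => ?_)
  rw [pullback, LinearIsometryEquiv.norm_map]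

theorem duhamelIntegrand_eq {w w' : ℝ → ℝ} {T : ℝ} (heq : ∀ t ∈ Icc 0 T, w' t = w t) (ψ : ℝ → L2)
    {t s : ℝ} (ht : t ∈ Icc 0 T) (hs : s ∈ Icc 0 T) :
    duhamelIntegrand w ψ t s = schrodingerGroup (w' t) (pullback w' ψ s) := by
  rw [duhamelIntegrand, modulatedGroup, modulatedGroup, schrodingerGroup_symm_apply, pullback,
    heq t ht, heq s hs]

theorem intervalIntegrable_pullback {w : ℝ → ℝ} (hw : Continuous w) {τ : ℝ} {ψ : ℝ → L2}
    (hψ : Integrable ψ (volume.restrict (Icc 0 τ))) {t : ℝ} (ht : t ∈ Icc 0 τ) :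
    IntervalIntegrable (pullback w ψ) volume 0 t := by
  rw [intervalIntegrable_iff_integrableOn_Icc_of_le ht.1]
  exact IntegrableOn.mono_set (integrable_pullback hw hψ) (Icc_subset_Icc_right ht.2)

theorem intervalIntegrable_duhamelIntegrand {w w' : ℝ → ℝ} {T : ℝ} (hw' : Continuous w')
    (heq : ∀ t ∈ Icc 0 T, w' t = w t) {τ : ℝ} (hτT : τ ≤ T) {ψ : ℝ → L2}
    (hψ : Integrable ψ (volume.restrict (Icc 0 τ))) {t : ℝ} (ht : t ∈ Icc 0 τ) :
    IntervalIntegrable (duhamelIntegrand w ψ t) volume 0 t := by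
  have h1 :
      IntervalIntegrable (fun s => schrodingerGroup (w' t) (pullback w' ψ s)) volume 0 t := by
    have h := intervalIntegrable_pullback hw' hψ ht
    exact ⟨(schrodingerGroup (w' t)).toContinuousLinearEquiv.toContinuousLinearMap.integrable_comp
      h.1, (schrodingerGroup (w' t)).toContinuousLinearEquiv.toContinuousLinearMap.integrable_comp
      h.2⟩
  refine h1.congr fun s hs => ?_
  rw [uIoc_of_le ht.1] at hs
  exact (duhamelIntegrand_eq heq ψ ⟨ht.1, ht.2.trans hτT⟩
    ⟨hs.1.le, hs.2.trans (ht.2.trans hτT)⟩).symm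

theorem duhamel_eq_primitiveFlow {w w' : ℝ → ℝ} {T : ℝ} (hw' : Continuous w')
    (heq : ∀ t ∈ Icc 0 T, w' t = w t) {τ : ℝ} (hτT : τ ≤ T) {ψ : ℝ → L2}
    (hψ : Integrable ψ (volume.restrict (Icc 0 τ))) {t : ℝ} (ht : t ∈ Icc 0 τ) :
    duhamel w ψ t = primitiveFlow w' (volume.restrict (Icc 0 τ)) (pullback w' ψ) t := by
  have h1 : duhamel w ψ t = ∫ s in (0 : ℝ)..t, schrodingerGroup (w' t) (pullback w' ψ s) := by
    refine intervalIntegral.integral_congr fun s hs => ?_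
    rw [uIcc_of_le ht.1] at hs
    exact duhamelIntegrand_eq heq ψ ⟨ht.1, ht.2.trans hτT⟩
      ⟨hs.1, hs.2.trans (ht.2.trans hτT)⟩
  have h2 : ∫ s in (0 : ℝ)..t, schrodingerGroup (w' t) (pullback w' ψ s) =
      schrodingerGroup (w' t) (∫ s in (0 : ℝ)..t, pullback w' ψ s) :=
    ContinuousLinearMap.intervalIntegral_comp_comm
      (schrodingerGroup (w' t)).toContinuousLinearEquiv.toContinuousLinearMap
      (intervalIntegrable_pullback hw' hψ ht)
  have h3 : ∫ s in (0 : ℝ)..t, pullback w' ψ s =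
      ∫ s in (0 : ℝ)..t, pullback w' ψ s ∂(volume.restrict (Icc 0 τ)) := by
    rw [intervalIntegral.integral_of_le ht.1, intervalIntegral.integral_of_le ht.1,
      Measure.restrict_restrict measurableSet_Ioc, inter_eq_left.2]
    exact Ioc_subset_Icc_self.trans (Icc_subset_Icc_right ht.2)
  rw [h1, h2, h3, primitiveFlow]

/-- From a bound on the `L^p` norm of `t ↦ ‖u_t‖_{L^q}`, for `u` equal on `[0, τ]` to a continuous
`L²`-valued function, to membership in the Bochner space. -/
theorem mixedNormLE_of_lintegral_le {p : ℝ} (hp : 0 < p) {q : ℝ≥0∞} (hq : 1 ≤ q) (hq' : q ≠ ∞)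
    {τ : ℝ} {u u' : ℝ → L2} (hu' : Continuous u') (heq : ∀ t ∈ Icc 0 τ, u t = u' t) {M : ℝ≥0∞}
    (hM : M ≠ ∞) (h : (∫⁻ t in Icc 0 τ, eLpNorm (u' t) q volume ^ p) ^ (1 / p) ≤ M) :
    MixedNormLE (ENNReal.ofReal p) q hq τ u M := by
  have : Fact (1 ≤ q) := ⟨hq⟩
  obtain ⟨v, hvm, hv⟩ := exists_stronglyMeasurable_eLpNorm_eq hq' hu'
  have hN : Measurable fun t => eLpNorm (u' t) q volume ^ p :=
    (LowerSemicontinuous.comp (lowerSemicontinuous_eLpNorm q) hu').measurable.pow_const p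
  have hfin : ∫⁻ t in Icc 0 τ, eLpNorm (u' t) q volume ^ p ≠ ∞ := by
    intro htop
    rw [htop, ENNReal.top_rpow_of_pos (by positivity), top_le_iff] at h
    exact hM h
  have hae : ∀ᵐ t ∂(volume.restrict (Icc 0 τ)), eLpNorm (u' t) q volume < ∞ := by
    filter_upwards [ae_lt_top hN hfin] with t ht
    exact lt_top_iff_ne_top.2 fun h0 => ht.ne (by rw [h0, ENNReal.top_rpow_of_pos hp])
  have hnorm : eLpNorm v (ENNReal.ofReal p) (volume.restrict (Icc 0 τ)) ≤ M := by
    rw [eLpNorm_eq_lintegral_rpow_enorm_toReal (by simpa using hp) ENNReal.ofReal_ne_top,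
      ENNReal.toReal_ofReal hp.le]
    refine le_of_eq_of_le ?_ h
    congr 1
    refine lintegral_congr_ae ?_
    filter_upwards [hae] with t ht
    rw [(hv t ht).2]
  refine ⟨v, ?_, ⟨hvm.aestronglyMeasurable, hnorm.trans_lt (lt_top_iff_ne_top.2 hM)⟩, hnorm⟩
  filter_upwards [hae, ae_restrict_mem measurableSet_Icc] with t ht htI
  rw [heq t htI]
  exact (hv t ht).1

end ModulatedSchrodinger

theorem mainTheorem3 (p : ℝ) (hp : p ∈ Set.Ioc (2 : ℝ) 5) :
    ∃ γstar : ℝ, 0 < γstar ∧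
      ∀ (ρ γ T : ℝ) (w : ℝ → ℝ), 0 < T → min (3 / 2 - 2 / p) 1 < ρ → 1 / 2 < γ →
        ModulatedSchrodinger.IsIrregularOn ρ γ T w →
        ∃ C : ℝ, 0 < C ∧
          ∀ T' : ℝ, 0 < T' → T' ≤ T →
            ∀ ψ : ℝ → ModulatedSchrodinger.L2,
              MeasureTheory.MemLp ψ 1 (MeasureTheory.volume.restrict (Set.Icc 0 T')) →
              (∀ t ∈ Set.Icc 0 T', IntervalIntegrable
                (ModulatedSchrodinger.duhamelIntegrand w ψ t) MeasureTheory.volume 0 t) ∧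
              ModulatedSchrodinger.MixedNormLE (ENNReal.ofReal p) (ENNReal.ofReal (2 * p))
                (ModulatedSchrodinger.one_le_ofReal_two_mul hp) T'
                (ModulatedSchrodinger.duhamel w ψ)
                (ENNReal.ofReal (C * T' ^ γstar) *
                  MeasureTheory.eLpNorm ψ 1 (MeasureTheory.volume.restrict (Set.Icc 0 T'))) := by
  have hp0 : 0 < p := by linarith [hp.1]
  refine ⟨1 / (2 * p), by positivity, fun ρ γ T w hT hρ hγ hw => ?_⟩
  -- a continuous extension of the path to the line
  obtain ⟨w', hw', heq⟩ : ∃ w' : ℝ → ℝ, Continuous w' ∧ ∀ t ∈ Icc 0 T, w' t = w t :=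
    ⟨IccExtend hT.le ((Icc 0 T).domRestrict w),
      (continuousOn_iff_continuous_domRestrict.1 hw.continuousOn).Icc_extend',
      fun t ht => IccExtend_of_mem hT.le _ ht⟩
  obtain ⟨C, hC, hom⟩ :=
    (hw.congr hw' heq).exists_strichartzIntegral_le hp hT hρ hγ hw'
  refine ⟨C, hC, fun τ hτ hτT ψ hψ => ?_⟩
  have hψi := memLp_one_iff_integrable.1 hψ
  refine ⟨fun t ht =>
    ModulatedSchrodinger.intervalIntegrable_duhamelIntegrand hw' heq hτT hψi ht, ?_⟩
  have hχ := ModulatedSchrodinger.integrable_pullback hw' hψi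
  refine ModulatedSchrodinger.mixedNormLE_of_lintegral_le hp0 _ ENNReal.ofReal_ne_top
    (ModulatedSchrodinger.continuous_primitiveFlow hw' hχ)
    (fun t ht => ModulatedSchrodinger.duhamel_eq_primitiveFlow hw' heq hτT hψi ht)
    (ENNReal.mul_ne_top ENNReal.ofReal_ne_top hψ.2.ne) ?_
  have hmink := ModulatedSchrodinger.lintegral_primitiveFlow_le (by linarith [hp.1])
    (ModulatedSchrodinger.one_le_ofReal_two_mul hp) hw' ENNReal.ofReal_ne_top
    (hom τ hτ hτT) hχ
  simpa only [ModulatedSchrodinger.enorm_pullback, ← eLpNorm_one_eq_lintegral_enorm] using hmink
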